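/- Let $k$ be a number field, let $F_R$ and $F_L$ be finite field extensions of $k$, and let $n\ge 0$ be an integer. For a commutative ring $S$ let $T_n(S)$, respectively $T_n^t(S)$, be the group of invertible upper, respectively lower, triangular $n\times n$ matrices over $S$. Definitions. An affine group scheme over $k$ is a group-valued functor on commutative $k$-algebras whose underlying set-valued functor is representable; an affine bisemigroup scheme over $k$ is a pair $H=(H_R,H_L)$ of affine group schemes over $k$. A finite-dimensional representation of $H$ is a finite-dimensional $k$-vector space $V$ with, for every commutative $k$-algebra $A$ and naturally in $A$, a right action of $H_R(A)$ and a left action of $H_L(A)$ on $A\otimes_k V$ that are $A$-linear and commute. These representations, with equivariant $k$-linear maps and the diagonal action on tensor products over $k$, form a $k$-linear symmetric monoidal category $\mathrm{Rep}_k(H)$. The bilinear algebraic semigroup $\mathrm{GL}_n(F_R\times F_L)=T_n^t(F_R)\times T_n(F_L)$ is the pair of functors $A\mapsto T_n^t(A\otimes_k F_R)$, $A\mapsto T_n(A\otimes_k F_L)$. Let $V_R=F_R^n$ (row vectors) with the right action $v\mapsto va$ of $T_n^t$ and the trivial action of $T_n$, let $V_L=F_L^n$ (column vectors) with the left action $w\mapsto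 bw$ of $T_n$ and the trivial action of $T_n^t$, and put $G^{(n)}(F_R\times F_L)=V_R\otimes_k V_L$. A bisemimodule over $F_R\times F_L$ is a module over $F_R\otimes_k F_L$; on $V_R\otimes_k V_L$ the scalars act by $(x\otimes y)(v\otimes w)=xv\otimes yw$. A neutral Tannakian category over $k$ is a $k$-linear rigid abelian symmetric monoidal category with bilinear tensor product and $k=\mathrm{End}(\mathbf 1)$, together with an exact faithful $k$-linear tensor functor (the fibre functor) to finite-dimensional $k$-vector spaces. Proposition. 1. $\mathrm{GL}_n(F_R\times F_L)$ is an affine bisemigroup scheme over $k$. 2. $G^{(n)}(F_R\times F_L)=V_R\otimes_k V_L$ is an $n^2$-dimensional bisemimodule over $F_R\times F_L$, that is, a free $F_R\otimes_k F_L$-module of rank $n^2$. 3. $G^{(n)}(F_R\times F_L)$ is a representation space of $\mathrm{GL}_n(F_R\times F_L)$, acting right by left: $a\in T_n^t(F_R)$ and $b\in T_n(F_L)$ act by $v\otimes w\mapsto va\otimes bw$, and for every commutative $k$-algebra $A$ the $A$-valued points of $\mathrm{GL}_n(F_R\times F_L)$ act on $A\otimes_k(V_R\otimes_k V_L)$ by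 $F_R\otimes_k F_L$-linear maps. 4. $G^{(n)}(F_R\times F_L)$ belongs to a neutral Tannakian category equivalent to the category of finite-dimensional representations of $\mathrm{GL}_n(F_R\times F_L)$: there are a neutral Tannakian category $\underline c_{R\times L}$ over $k$, a $k$-linear tensor equivalence $\underline c_{R\times L}\simeq\mathrm{Rep}_k(\mathrm{GL}_n(F_R\times F_L))$ carrying the fibre functor to the forgetful functor (up to isomorphism of tensor functors), and an object of $\underline c_{R\times L}$ corresponding to $G^{(n)}(F_R\times F_L)$. Likewise, for every affine bisemigroup scheme $H$ over $k$ there is a neutral Tannakian category over $k$ that is equivalent in this sense to $\mathrm{Rep}_k(H)$. -/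

import Mathlib

open CategoryTheory MonoidalCategory
open scoped TensorProduct

universe u

namespace Bisemi

/-! ### Triangular matrix groups -/

section Triangular

variable (n : ℕ) (R : Type*) [CommRing R]

/-- The Borel group `T_n(R)` of invertible upper triangular `n × n` matrices. -/
def upper : Subgroup (GL (Fin n) R) where
  carrier := {g | (g : Matrix (Fin n) (Fin n) R).BlockTriangular id}
  mul_mem' := fun ha hb => by
    simp only [Set.mem_ofPred_eq] at ha hb ⊢
    rw [Units.val_mul]
    exact ha.mul hb
  one_mem' := by
    simp only [Set.mem_ofPred_eq]
    rw [Units.val_one]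
    exact Matrix.blockTriangular_one
  inv_mem' := fun {g} hg => by
    simp only [Set.mem_ofPred_eq] at hg ⊢
    rw [Matrix.coe_units_inv]
    have : Invertible (g : Matrix (Fin n) (Fin n) R) := g.invertible
    exact Matrix.blockTriangular_inv_of_blockTriangular hg

/-- The group `T_n^t(R)` of invertible lower triangular `n × n` matrices. -/
def lower : Subgroup (GL (Fin n) R) where
  carrier := {g | (g : Matrix (Fin n) (Fin n) R).BlockTriangular OrderDual.toDual}
  mul_mem' := fun ha hb => by
    simp only [Set.mem_ofPred_eq] at ha hb ⊢
    rw [Units.val_mul]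
    exact ha.mul hb
  one_mem' := by
    simp only [Set.mem_ofPred_eq]
    rw [Units.val_one]
    exact Matrix.blockTriangular_one
  inv_mem' := fun {g} hg => by
    simp only [Set.mem_ofPred_eq] at hg ⊢
    rw [Matrix.coe_units_inv]
    have : Invertible (g : Matrix (Fin n) (Fin n) R) := g.invertible
    exact Matrix.blockTriangular_inv_of_blockTriangular hg

variable {R} {S : Type*} [CommRing S]

/-- Entrywise application of a ring homomorphism, `T_n(R) → T_n(S)`. -/
def upperMap (f : R →+* S) : upper n R →* upper n S :=
  ((Matrix.GeneralLinearGroup.map f).comp (upper n R).subtype).codRestrict (upper n S)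
    fun g => by
      have hg : ((g : GL (Fin n) R) : Matrix (Fin n) (Fin n) R).BlockTriangular id := g.2
      exact hg.map f

/-- Entrywise application of a ring homomorphism, `T_n^t(R) → T_n^t(S)`. -/
def lowerMap (f : R →+* S) : lower n R →* lower n S :=
  ((Matrix.GeneralLinearGroup.map f).comp (lower n R).subtype).codRestrict (lower n S)
    fun g => by
      have hg : ((g : GL (Fin n) R) : Matrix (Fin n) (Fin n) R).BlockTriangular
        OrderDual.toDual := g.2
      exact hg.map f

end Triangular

/-! ### Group schemes and bisemigroup schemes as functors of points -/

section Functors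

variable (k : Type u) [Field k]

/-- Group-valued functors on commutative `k`-algebras. -/
abbrev GroupFunctor := CommAlgCat.{u} k ⥤ GrpCat.{u}

variable {k}

/-- A group functor is an affine group scheme over `k` if its underlying functor to sets is
representable by a commutative `k`-algebra. -/
def GroupFunctor.IsAffine (G : GroupFunctor k) : Prop :=
  (G ⋙ forget GrpCat.{u}).IsCorepresentable

variable (k)

/-- A right-by-left pair of group functors on commutative `k`-algebras: the right component acts
from the right, the left component from the left. -/
structure BisemigroupFunctor where
  /-- the component acting from the right -/
  right : GroupFunctor k
  /-- the component acting from the left -/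
  left : GroupFunctor k

variable {k}

namespace BisemigroupFunctor

/-- An affine bisemigroup scheme: both components are representable. -/
def IsAffine (H : BisemigroupFunctor k) : Prop :=
  H.right.IsAffine ∧ H.left.IsAffine

/-- The group functor `A ↦ H_R(A)ᵐᵒᵖ × H_L(A)`.  An action of it is the same thing as a right action
of `H_R` together with a left action of `H_L` commuting with it. -/
def total (H : BisemigroupFunctor k) : GroupFunctor k where
  obj A := GrpCat.of ((H.right.obj A)ᵐᵒᵖ × H.left.obj A)
  map f := GrpCat.ofHom (MonoidHom.prodMap (MonoidHom.op (H.right.map f).hom) (H.left.map f).hom)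
  map_id A := by ext x <;> simp
  map_comp f g := by ext x <;> simp

end BisemigroupFunctor

variable (k)

/-- `T_n` over a `k`-algebra `F`, as the group functor `A ↦ T_n(A ⊗ F)` on `k`-algebras. -/
def upperFunctor (F : Type u) [CommRing F] [Algebra k F] (n : ℕ) : GroupFunctor k where
  obj A := GrpCat.of (upper n (A ⊗[k] F))
  map f := GrpCat.ofHom
    (upperMap n (Algebra.TensorProduct.map f.hom (AlgHom.id k F)).toRingHom)
  map_id A := by
    ext x i j
    simp [upperMap]
  map_comp f g := by
    ext x i j
    simp [upperMap, ← AlgHom.comp_apply, ← Algebra.TensorProduct.map_comp]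

/-- `T_n^t` over a `k`-algebra `F`, as the group functor `A ↦ T_n^t(A ⊗ F)` on `k`-algebras. -/
def lowerFunctor (F : Type u) [CommRing F] [Algebra k F] (n : ℕ) : GroupFunctor k where
  obj A := GrpCat.of (lower n (A ⊗[k] F))
  map f := GrpCat.ofHom
    (lowerMap n (Algebra.TensorProduct.map f.hom (AlgHom.id k F)).toRingHom)
  map_id A := by
    ext x i j
    simp [lowerMap]
  map_comp f g := by
    ext x i j
    simp [lowerMap, ← AlgHom.comp_apply, ← Algebra.TensorProduct.map_comp]

/-- The bilinear algebraic semigroup `GL_n(F_R × F_L) = T_n^t(F_R) × T_n(F_L)`. -/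
def GLn (FR FL : Type u) [CommRing FR] [Algebra k FR] [CommRing FL] [Algebra k FL] (n : ℕ) :
    BisemigroupFunctor k where
  right := lowerFunctor k FR n
  left := upperFunctor k FL n

/-- The `A`-valued point of `GL_n(F_R × F_L)` given by a pair of triangular matrices with entries in
`F_R` and `F_L`. -/
def point (FR FL : Type u) [CommRing FR] [Algebra k FR] [CommRing FL] [Algebra k FL] (n : ℕ)
    (A : CommAlgCat.{u} k) (a : lower n FR) (b : upper n FL) :
    (GLn k FR FL n).total.obj A :=
  (MulOpposite.op (lowerMap n
      (Algebra.TensorProduct.includeRight : FR →ₐ[k] A ⊗[k] FR).toRingHom a),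
    upperMap n (Algebra.TensorProduct.includeRight : FL →ₐ[k] A ⊗[k] FL).toRingHom b)

end Functors

/-! ### Finite-dimensional representations of a group functor -/

section PairLemmas

variable {k : Type*} [Field k] (A : Type*) [CommRing A] [Algebra k A]
variable {V W : Type*} [AddCommGroup V] [Module k V] [AddCommGroup W] [Module k W]

/-- The canonical `A`-bilinear pairing `(A ⊗ V) × (A ⊗ W) → A ⊗ (V ⊗ W)`. -/
noncomputable def pair (p : A ⊗[k] V) (q : A ⊗[k] W) : A ⊗[k] (V ⊗[k] W) :=
  (TensorProduct.AlgebraTensorModule.distribBaseChange k A V W).symm (p ⊗ₜ[A] q)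

@[simp] lemma pair_tmul (a b : A) (v : V) (w : W) :
    pair A (a ⊗ₜ[k] v) (b ⊗ₜ[k] w) = (a * b) ⊗ₜ[k] (v ⊗ₜ[k] w) := by
  simp [pair]

lemma pair_add_left (p p' : A ⊗[k] V) (q : A ⊗[k] W) :
    pair A (p + p') q = pair A p q + pair A p' q := by
  simp [pair, TensorProduct.add_tmul]

lemma pair_add_right (p : A ⊗[k] V) (q q' : A ⊗[k] W) :
    pair A p (q + q') = pair A p q + pair A p q' := by
  simp [pair, TensorProduct.tmul_add]

@[simp] lemma pair_zero_left (q : A ⊗[k] W) : pair A (0 : A ⊗[k] V) q = 0 := by simp [pair]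

@[simp] lemma pair_zero_right (p : A ⊗[k] V) : pair A p (0 : A ⊗[k] W) = 0 := by simp [pair]

lemma pair_induction {P : A ⊗[k] (V ⊗[k] W) → Prop} (h0 : P 0)
    (hp : ∀ p q, P (pair A p q)) (hadd : ∀ x y, P x → P y → P (x + y)) (x) : P x := by
  obtain ⟨y, rfl⟩ :=
    (TensorProduct.AlgebraTensorModule.distribBaseChange k A V W).symm.surjective x
  induction y using TensorProduct.induction_on with
  | zero => simpa using h0
  | tmul p q => exact hp p q
  | add x y hx hy => rw [map_add]; exact hadd _ _ hx hy

/-- Two bi-additive expressions agree as soon as they do on pure tensors. -/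
lemma tmul_induction₂ {P : A ⊗[k] V → A ⊗[k] W → Prop}
    (h1 : ∀ q, P 0 q) (h2 : ∀ p, P p 0)
    (h : ∀ a v b w, P (a ⊗ₜ v) (b ⊗ₜ w))
    (ha : ∀ p p' q, P p q → P p' q → P (p + p') q)
    (hb : ∀ p q q', P p q → P p q' → P p (q + q')) (p q) : P p q := by
  induction p using TensorProduct.induction_on with
  | zero => exact h1 q
  | add p p' hp hp' => exact ha _ _ _ hp hp'
  | tmul a v =>
    induction q using TensorProduct.induction_on with
    | zero => exact h2 _
    | add q q' hq hq' => exact hb _ _ _ hq hq'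
    | tmul b w => exact h a v b w

/-- The tensor product of two endomorphisms after base change. -/
noncomputable def pairEnd (f : Module.End A (A ⊗[k] V)) (g : Module.End A (A ⊗[k] W)) :
    Module.End A (A ⊗[k] (V ⊗[k] W)) :=
  (TensorProduct.AlgebraTensorModule.distribBaseChange k A V W).symm.conj (TensorProduct.map f g)

@[simp] lemma pairEnd_pair (f : Module.End A (A ⊗[k] V)) (g : Module.End A (A ⊗[k] W)) (p q) :
    pairEnd A f g (pair A p q) = pair A (f p) (g q) := by
  simp [pairEnd, pair, LinearEquiv.conj_apply]

variable {V' W' : Type*} [AddCommGroup V'] [Module k V'] [AddCommGroup W'] [Module k W']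

lemma baseChange_map_pair (f : V →ₗ[k] V') (g : W →ₗ[k] W') (p : A ⊗[k] V) (q : A ⊗[k] W) :
    (TensorProduct.map f g).baseChange A (pair A p q) =
      pair A (f.baseChange A p) (g.baseChange A q) := by
  induction p, q using tmul_induction₂ <;> simp_all [pair_add_left, pair_add_right]

lemma rTensor_pair {B : Type*} [CommRing B] [Algebra k B] (f : A →ₐ[k] B)
    (p : A ⊗[k] V) (q : A ⊗[k] W) :
    f.toLinearMap.rTensor _ (pair A p q) =
      pair B (f.toLinearMap.rTensor _ p) (f.toLinearMap.rTensor _ q) := by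
  induction p, q using tmul_induction₂ <;> simp_all [pair_add_left, pair_add_right]

lemma baseChange_lid_pair (p : A ⊗[k] k) (q : A ⊗[k] W) :
    (TensorProduct.lid k W).toLinearMap.baseChange A (pair A p q) =
      TensorProduct.AlgebraTensorModule.rid k A A p • q := by
  induction p, q using tmul_induction₂ <;>
    simp_all [pair_add_left, pair_add_right, add_smul, TensorProduct.smul_tmul']

lemma baseChange_rid_pair (p : A ⊗[k] V) (q : A ⊗[k] k) :
    (TensorProduct.rid k V).toLinearMap.baseChange A (pair A p q) =
      TensorProduct.AlgebraTensorModule.rid k A A q • p := by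
  induction p, q using tmul_induction₂ <;>
    simp_all [pair_add_left, pair_add_right, add_smul, TensorProduct.smul_tmul', mul_comm]

lemma baseChange_comm_pair (p : A ⊗[k] V) (q : A ⊗[k] W) :
    (TensorProduct.comm k V W).toLinearMap.baseChange A (pair A p q) = pair A q p := by
  induction p, q using tmul_induction₂ <;>
    simp_all [pair_add_left, pair_add_right, mul_comm]

lemma baseChange_assoc_pair (p : A ⊗[k] V) (q : A ⊗[k] W) (r : A ⊗[k] W') :
    (TensorProduct.assoc k V W W').toLinearMap.baseChange A (pair A (pair A p q) r) =
      pair A p (pair A q r) := by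
  induction p, q using tmul_induction₂ with
  | h1 q => simp
  | h2 p => simp
  | ha p p' q h h' => simp [pair_add_left, h, h']
  | hb p q q' h h' => simp [pair_add_left, pair_add_right, h, h']
  | h a v b w =>
    induction r using TensorProduct.induction_on with
    | zero => simp
    | add x y hx hy => simp only [pair_add_right, map_add, hx, hy]
    | tmul c x => simp [mul_assoc]

@[simp] lemma pairEnd_one : pairEnd A (1 : Module.End A (A ⊗[k] V))
    (1 : Module.End A (A ⊗[k] W)) = 1 := by
  ext x
  simp [pairEnd, LinearEquiv.conj_apply, Module.End.one_eq_id]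

lemma pairEnd_mul (f f' : Module.End A (A ⊗[k] V)) (g g' : Module.End A (A ⊗[k] W)) :
    pairEnd A (f * f') (g * g') = pairEnd A f g * pairEnd A f' g' := by
  refine LinearMap.ext fun x => ?_
  induction x using pair_induction (A := A) <;> simp_all

lemma lid_pairEnd (g : Module.End A (A ⊗[k] W)) (x : A ⊗[k] (k ⊗[k] W)) :
    (TensorProduct.lid k W).toLinearMap.baseChange A (pairEnd A 1 g x) =
      g ((TensorProduct.lid k W).toLinearMap.baseChange A x) := by
  induction x using pair_induction (A := A) (V := k) (W := W) with
  | h0 => simp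
  | hadd x y hx hy => simp only [map_add, hx, hy]
  | hp p q => rw [pairEnd_pair, baseChange_lid_pair, baseChange_lid_pair, map_smul]; rfl

lemma rid_pairEnd (g : Module.End A (A ⊗[k] V)) (x : A ⊗[k] (V ⊗[k] k)) :
    (TensorProduct.rid k V).toLinearMap.baseChange A (pairEnd A g 1 x) =
      g ((TensorProduct.rid k V).toLinearMap.baseChange A x) := by
  induction x using pair_induction (A := A) (V := V) (W := k) with
  | h0 => simp
  | hadd x y hx hy => simp only [map_add, hx, hy]
  | hp p q => rw [pairEnd_pair, baseChange_rid_pair, baseChange_rid_pair, map_smul]; rfl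

lemma comm_pairEnd (f : Module.End A (A ⊗[k] V)) (g : Module.End A (A ⊗[k] W)) (x) :
    (TensorProduct.comm k V W).toLinearMap.baseChange A (pairEnd A f g x) =
      pairEnd A g f ((TensorProduct.comm k V W).toLinearMap.baseChange A x) := by
  induction x using pair_induction (A := A) with
  | h0 => simp
  | hadd x y hx hy => simp only [map_add, hx, hy]
  | hp p q => rw [pairEnd_pair, baseChange_comm_pair, baseChange_comm_pair, pairEnd_pair]

lemma assoc_pairEnd (f : Module.End A (A ⊗[k] V)) (g : Module.End A (A ⊗[k] W))
    (h : Module.End A (A ⊗[k] W')) (x) :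
    (TensorProduct.assoc k V W W').toLinearMap.baseChange A (pairEnd A (pairEnd A f g) h x) =
      pairEnd A f (pairEnd A g h)
        ((TensorProduct.assoc k V W W').toLinearMap.baseChange A x) := by
  induction x using pair_induction (A := A) (V := V ⊗[k] W) (W := W') with
  | h0 => simp
  | hadd x y hx hy => simp only [map_add, hx, hy]
  | hp p r =>
    induction p using pair_induction (A := A) with
    | h0 => simp only [pair_zero_left, map_zero]
    | hadd x y hx hy => simp only [pair_add_left, map_add, hx, hy]
    | hp p q =>
      rw [pairEnd_pair, pairEnd_pair, baseChange_assoc_pair, baseChange_assoc_pair,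
        pairEnd_pair, pairEnd_pair]

lemma map_pairEnd (φ : V →ₗ[k] V') (ψ : W →ₗ[k] W') {f : Module.End A (A ⊗[k] V)}
    {g : Module.End A (A ⊗[k] W)} {f' : Module.End A (A ⊗[k] V')}
    {g' : Module.End A (A ⊗[k] W')} (hφ : ∀ x, φ.baseChange A (f x) = f' (φ.baseChange A x))
    (hψ : ∀ x, ψ.baseChange A (g x) = g' (ψ.baseChange A x)) (x) :
    (TensorProduct.map φ ψ).baseChange A (pairEnd A f g x) =
      pairEnd A f' g' ((TensorProduct.map φ ψ).baseChange A x) := by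
  induction x using pair_induction (A := A) with
  | h0 => simp
  | hadd x y hx hy => simp only [map_add, hx, hy]
  | hp p q => rw [pairEnd_pair, baseChange_map_pair, baseChange_map_pair, pairEnd_pair, hφ, hψ]

lemma rTensor_pairEnd {B : Type*} [CommRing B] [Algebra k B] (φ : A →ₐ[k] B)
    {f : Module.End A (A ⊗[k] V)} {g : Module.End A (A ⊗[k] W)}
    {f' : Module.End B (B ⊗[k] V)} {g' : Module.End B (B ⊗[k] W)}
    (hf : ∀ x, φ.toLinearMap.rTensor V (f x) = f' (φ.toLinearMap.rTensor V x))
    (hg : ∀ x, φ.toLinearMap.rTensor W (g x) = g' (φ.toLinearMap.rTensor W x)) (x) :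
    φ.toLinearMap.rTensor (V ⊗[k] W) (pairEnd A f g x) =
      pairEnd B f' g' (φ.toLinearMap.rTensor (V ⊗[k] W) x) := by
  induction x using pair_induction (A := A) with
  | h0 => simp
  | hadd x y hx hy => simp only [map_add, hx, hy]
  | hp p q => rw [pairEnd_pair, rTensor_pair, rTensor_pair, pairEnd_pair, hf, hg]

end PairLemmas

/-- A finite-dimensional representation of a group functor `G` over `k`: a finite-dimensional
`k`-vector space `V` with an `A`-linear action of `G(A)` on `A ⊗ V`, natural in the commutative
`k`-algebra `A`; that is, a morphism of group functors `G → GL_V`. -/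
structure RepCat {k : Type u} [Field k] (G : GroupFunctor k) where
  /-- the underlying finite-dimensional vector space -/
  V : FGModuleCat.{u} k
  /-- the action on `A`-valued points -/
  ρ (A : CommAlgCat.{u} k) : G.obj A →* Module.End A (A ⊗[k] V)
  natural {A B : CommAlgCat.{u} k} (f : A ⟶ B) (g : G.obj A) (x : A ⊗[k] V) :
    f.hom.toLinearMap.rTensor V (ρ A g x) =
      ρ B ((G.map f).hom g) (f.hom.toLinearMap.rTensor V x)

namespace RepCat

variable {k : Type u} [Field k] {G : GroupFunctor k}

/-- Morphisms of representations: equivariant linear maps. -/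
@[ext]
structure Hom (X Y : RepCat G) where
  /-- the underlying linear map -/
  hom : X.V ⟶ Y.V
  comm (A : CommAlgCat.{u} k) (g : G.obj A) (x : A ⊗[k] X.V) :
    hom.hom.hom.baseChange A (X.ρ A g x) = Y.ρ A g (hom.hom.hom.baseChange A x)

@[simps]
instance : Category (RepCat G) where
  Hom := Hom
  id X := ⟨𝟙 _, fun A g x => by simp⟩
  comp f g := ⟨f.hom ≫ g.hom, fun A a x => by
    simp [LinearMap.baseChange_comp, f.comm, g.comm]⟩

@[ext] lemma hom_ext {X Y : RepCat G} {f g : X ⟶ Y} (h : f.hom = g.hom) : f = g := Hom.ext h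

variable (G) in
/-- The forgetful functor to finite-dimensional vector spaces. -/
@[simps]
def forget : RepCat G ⥤ FGModuleCat.{u} k where
  obj X := X.V
  map f := f.hom

instance : (forget G).Faithful where
  map_injective h := hom_ext h

/-- Isomorphisms of representations from equivariant isomorphisms. -/
def mkIso {X Y : RepCat G} (e : X.V ≅ Y.V)
    (h : ∀ (A : CommAlgCat.{u} k) (g : G.obj A) (x : A ⊗[k] X.V),
      e.hom.hom.hom.baseChange A (X.ρ A g x) = Y.ρ A g (e.hom.hom.hom.baseChange A x)) :
    X ≅ Y where
  hom := ⟨e.hom, h⟩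
  inv := ⟨e.inv, fun A g x => by
    have h1 : ∀ z : A ⊗[k] X.V,
        e.inv.hom.hom.baseChange A (e.hom.hom.hom.baseChange A z) = z := fun z => by
      rw [← LinearMap.comp_apply, ← LinearMap.baseChange_comp, ← FGModuleCat.hom_hom_comp]
      simp
    have h2 : ∀ z : A ⊗[k] Y.V,
        e.hom.hom.hom.baseChange A (e.inv.hom.hom.baseChange A z) = z := fun z => by
      rw [← LinearMap.comp_apply, ← LinearMap.baseChange_comp, ← FGModuleCat.hom_hom_comp]
      simp
    conv_lhs => rw [← h2 x, ← h, h1]⟩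
  hom_inv_id := hom_ext e.hom_inv_id
  inv_hom_id := hom_ext e.inv_hom_id

/-! #### Linear structure -/

instance (X Y : RepCat G) : Zero (X ⟶ Y) := ⟨⟨0, fun A g x => by
  simp [LinearMap.baseChange_zero]⟩⟩

instance (X Y : RepCat G) : Add (X ⟶ Y) := ⟨fun f g => ⟨f.hom + g.hom, fun A a x => by
  have h : (f.hom + g.hom).hom.hom = f.hom.hom.hom + g.hom.hom.hom := rfl
  simp [h, LinearMap.baseChange_add, f.comm, g.comm]⟩⟩

instance (X Y : RepCat G) : Neg (X ⟶ Y) := ⟨fun f => ⟨-f.hom, fun A a x => by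
  have h : (-f.hom).hom.hom = -f.hom.hom.hom := rfl
  simp [h, LinearMap.baseChange_neg, f.comm]⟩⟩

instance (X Y : RepCat G) : SMul k (X ⟶ Y) := ⟨fun c f => ⟨c • f.hom, fun A a x => by
  have h : (c • f.hom).hom.hom = c • f.hom.hom.hom := rfl
  simp [h, LinearMap.baseChange_smul, f.comm]⟩⟩

@[simp] lemma zero_hom (X Y : RepCat G) : (0 : X ⟶ Y).hom = 0 := rfl
@[simp] lemma add_hom {X Y : RepCat G} (f g : X ⟶ Y) : (f + g).hom = f.hom + g.hom := rfl
@[simp] lemma neg_hom {X Y : RepCat G} (f : X ⟶ Y) : (-f).hom = -f.hom := rfl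
@[simp] lemma smul_hom {X Y : RepCat G} (c : k) (f : X ⟶ Y) : (c • f).hom = c • f.hom := rfl

instance (X Y : RepCat G) : AddCommGroup (X ⟶ Y) where
  add_assoc _ _ _ := hom_ext (add_assoc _ _ _)
  zero_add _ := hom_ext (zero_add _)
  add_zero _ := hom_ext (add_zero _)
  add_comm _ _ := hom_ext (add_comm _ _)
  neg_add_cancel _ := hom_ext (neg_add_cancel _)
  nsmul := nsmulRec
  zsmul := zsmulRec

instance (X Y : RepCat G) : Module k (X ⟶ Y) where
  one_smul _ := hom_ext (one_smul _ _)
  mul_smul _ _ _ := hom_ext (mul_smul _ _ _)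
  smul_zero _ := hom_ext (smul_zero _)
  smul_add _ _ _ := hom_ext (smul_add _ _ _)
  add_smul _ _ _ := hom_ext (add_smul _ _ _)
  zero_smul _ := hom_ext (zero_smul _ _)

instance : Preadditive (RepCat G) where
  add_comp _ _ _ f g h := hom_ext (Preadditive.add_comp _ _ _ f.hom g.hom h.hom)
  comp_add _ _ _ f g h := hom_ext (Preadditive.comp_add _ _ _ f.hom g.hom h.hom)

instance : Linear k (RepCat G) where
  smul_comp _ _ _ r f g := hom_ext (Linear.smul_comp _ _ _ r f.hom g.hom)
  comp_smul _ _ _ f r g := hom_ext (Linear.comp_smul _ _ _ f.hom r g.hom)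

instance : (forget G).Additive where
instance : (forget G).Linear k where

/-! #### Tensor structure -/

/-- The tensor product of representations, with the diagonal action. -/
noncomputable def tensor (X Y : RepCat G) : RepCat G where
  V := X.V ⊗ Y.V
  ρ A :=
    { toFun g := pairEnd (V := X.V) (W := Y.V) A (X.ρ A g) (Y.ρ A g)
      map_one' := by
        rw [map_one, map_one]
        exact pairEnd_one (V := X.V) (W := Y.V) A
      map_mul' a b := by
        rw [map_mul, map_mul]
        exact pairEnd_mul (V := X.V) (W := Y.V) A _ _ _ _ }
  natural f g x :=
    rTensor_pairEnd (V := X.V) (W := Y.V) _ f.hom (X.natural f g) (Y.natural f g) x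

/-- The trivial one-dimensional representation. -/
noncomputable def triv (G : GroupFunctor k) : RepCat G where
  V := 𝟙_ (FGModuleCat.{u} k)
  ρ _ := 1
  natural _ _ _ := rfl

/-- The tensor product of equivariant maps. -/
noncomputable def tensorMap {X Y X' Y' : RepCat G} (f : X ⟶ X') (g : Y ⟶ Y') :
    tensor X Y ⟶ tensor X' Y' where
  hom := f.hom ⊗ₘ g.hom
  comm A a x := map_pairEnd (V := X.V) (W := Y.V) (V' := X'.V) (W' := Y'.V) A
    f.hom.hom.hom g.hom.hom.hom (f.comm A a) (g.comm A a) x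

/-- The left unit constraint. -/
noncomputable def lUnitor (X : RepCat G) : tensor (triv G) X ≅ X :=
  mkIso (λ_ X.V) fun A g x => lid_pairEnd (W := X.V) A (X.ρ A g) x

/-- The right unit constraint. -/
noncomputable def rUnitor (X : RepCat G) : tensor X (triv G) ≅ X :=
  mkIso (ρ_ X.V) fun A g x => rid_pairEnd (V := X.V) A (X.ρ A g) x

/-- The commutativity constraint. -/
noncomputable def braid (X Y : RepCat G) : tensor X Y ≅ tensor Y X :=
  mkIso (β_ X.V Y.V) fun A g x =>
    comm_pairEnd (V := X.V) (W := Y.V) A (X.ρ A g) (Y.ρ A g) x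

/-- The associativity constraint. -/
noncomputable def assoc (X Y Z : RepCat G) : tensor (tensor X Y) Z ≅ tensor X (tensor Y Z) :=
  mkIso (α_ X.V Y.V Z.V) fun A g x =>
    assoc_pairEnd (V := X.V) (W := Y.V) (W' := Z.V) A (X.ρ A g) (Y.ρ A g) (Z.ρ A g) x

noncomputable instance : MonoidalCategoryStruct (RepCat G) where
  tensorObj := tensor
  tensorUnit := triv G
  tensorHom := tensorMap
  whiskerLeft X _ _ f := tensorMap (𝟙 X) f
  whiskerRight f Y := tensorMap f (𝟙 Y)
  leftUnitor := lUnitor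
  rightUnitor := rUnitor
  associator := assoc

variable (G) in
/-- The forgetful functor carries the tensor structure on representations to that of
finite-dimensional vector spaces. -/
noncomputable def forgetInducing : Monoidal.InducingFunctorData (forget G) where
  μIso X Y := Iso.refl (X.V ⊗ Y.V)
  εIso := Iso.refl (𝟙_ (FGModuleCat.{u} k))
  whiskerLeft_eq X _ _ f := by
    change 𝟙 X.V ⊗ₘ f.hom = 𝟙 _ ≫ (X.V ◁ f.hom) ≫ 𝟙 _
    simp
  whiskerRight_eq f Y := by
    change f.hom ⊗ₘ 𝟙 Y.V = 𝟙 _ ≫ (f.hom ▷ Y.V) ≫ 𝟙 _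
    simp
  tensorHom_eq f g := by
    change f.hom ⊗ₘ g.hom = 𝟙 _ ≫ (f.hom ⊗ₘ g.hom) ≫ 𝟙 _
    simp
  associator_eq X Y Z := by
    change (α_ X.V Y.V Z.V).hom =
      (𝟙 _ ≫ (𝟙 _ ⊗ₘ 𝟙 _)) ≫ (α_ X.V Y.V Z.V).hom ≫ ((𝟙 _ ⊗ₘ 𝟙 _) ≫ 𝟙 _)
    simp only [id_tensorHom_id, Category.id_comp, Category.comp_id]
  leftUnitor_eq X := by
    change (λ_ X.V).hom = (𝟙 _ ≫ (𝟙 _ ⊗ₘ 𝟙 _)) ≫ (λ_ X.V).hom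
    simp only [id_tensorHom_id, Category.id_comp]
  rightUnitor_eq X := by
    change (ρ_ X.V).hom = (𝟙 _ ≫ (𝟙 _ ⊗ₘ 𝟙 _)) ≫ (ρ_ X.V).hom
    simp only [id_tensorHom_id, Category.id_comp]

noncomputable instance : MonoidalCategory (RepCat G) :=
  Monoidal.induced (forget G) (forgetInducing G)

noncomputable instance : (forget G).Monoidal :=
  Monoidal.fromInducedMonoidal (forget G) (forgetInducing G)

noncomputable instance : BraidedCategory (RepCat G) :=
  .ofFaithful (forget G) braid fun X Y => by
    change 𝟙 _ ≫ (β_ X.V Y.V).hom = (β_ X.V Y.V).hom ≫ 𝟙 _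
    simp

noncomputable instance : (forget G).Braided where
  braided X Y := by
    change 𝟙 _ ≫ (β_ X.V Y.V).hom = (β_ X.V Y.V).hom ≫ 𝟙 _
    simp

noncomputable instance : SymmetricCategory (RepCat G) :=
  .ofFaithful (forget G)

end RepCat

/-! ### The bisemimodule `G^{(n)}(F_R × F_L) = V_R ⊗ V_L` -/

section Bisemimodule

variable (k : Type u) [Field k]

section Actions

variable (A F : Type*) [CommRing A] [Algebra k A] [CommRing F] [Algebra k F] (n : ℕ)

/-- Matrices over `A ⊗ F` acting from the left on the column vectors `A ⊗ Fⁿ = (A ⊗ F)ⁿ`. -/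
noncomputable def mulVecEnd (M : Matrix (Fin n) (Fin n) (A ⊗[k] F)) :
    Module.End A (A ⊗[k] (Fin n → F)) :=
  (TensorProduct.piRight k A A (fun _ : Fin n => F)).symm.conj (M.mulVecLin.restrictScalars A)

/-- Matrices over `A ⊗ F` acting from the right on the row vectors `A ⊗ Fⁿ = (A ⊗ F)ⁿ`. -/
noncomputable def vecMulEnd (M : Matrix (Fin n) (Fin n) (A ⊗[k] F)) :
    Module.End A (A ⊗[k] (Fin n → F)) :=
  (TensorProduct.piRight k A A (fun _ : Fin n => F)).symm.conj (M.vecMulLinear.restrictScalars A)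

variable {k A F n}

lemma piRight_mulVecEnd (M : Matrix (Fin n) (Fin n) (A ⊗[k] F)) (x) :
    TensorProduct.piRight k A A (fun _ : Fin n => F) (mulVecEnd k A F n M x) =
      M.mulVec (TensorProduct.piRight k A A (fun _ : Fin n => F) x) := by
  simp [mulVecEnd, LinearEquiv.conj_apply]

lemma piRight_vecMulEnd (M : Matrix (Fin n) (Fin n) (A ⊗[k] F)) (x) :
    TensorProduct.piRight k A A (fun _ : Fin n => F) (vecMulEnd k A F n M x) =
      Matrix.vecMul (TensorProduct.piRight k A A (fun _ : Fin n => F) x) M := by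
  simp [vecMulEnd, LinearEquiv.conj_apply]

lemma piRight_rTensor {B : Type*} [CommRing B] [Algebra k B] (φ : A →ₐ[k] B)
    (x : A ⊗[k] (Fin n → F)) (i : Fin n) :
    TensorProduct.piRight k B B (fun _ : Fin n => F) (φ.toLinearMap.rTensor _ x) i =
      Algebra.TensorProduct.map φ (AlgHom.id k F)
        (TensorProduct.piRight k A A (fun _ : Fin n => F) x i) := by
  induction x using TensorProduct.induction_on <;> simp_all

end Actions

variable (FR FL : Type u) [Field FR] [Algebra k FR] [Field FL] [Algebra k FL] (n : ℕ)

/-- The affine bisemispace `V_R ⊗ V_L = F_Rⁿ ⊗ F_Lⁿ`. -/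
abbrev Bisemispace : Type u := (Fin n → FR) ⊗[k] (Fin n → FL)

/-- Scalar multiplication by `F_R ⊗ F_L` on `V_R ⊗ V_L`: `(a ⊗ b) (v ⊗ w) = a v ⊗ b w`. -/
noncomputable def scalar : FR ⊗[k] FL →ₐ[k] Module.End k (Bisemispace k FR FL n) :=
  Module.endTensorEndAlgHom.comp
    (Algebra.TensorProduct.map (Algebra.lsmul k k (Fin n → FR)) (Algebra.lsmul k k (Fin n → FL)))

lemma scalar_tmul (a : FR) (b : FL) (v : Fin n → FR) (w : Fin n → FL) :
    scalar k FR FL n (a ⊗ₜ b) (v ⊗ₜ w) = (a • v) ⊗ₜ (b • w) := by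
  simp [scalar, Module.endTensorEndAlgHom_apply]

/-- `V_R ⊗ V_L` as a bisemimodule over `F_R × F_L`, that is, as a module over `F_R ⊗ F_L`. -/
@[reducible]
noncomputable def bisemispaceModule : Module (FR ⊗[k] FL) (Bisemispace k FR FL n) :=
  Module.compHom _ (scalar k FR FL n).toRingHom

variable [FiniteDimensional k FR] [FiniteDimensional k FL]

/-- The left affine semispace `V_L = T^{(n)}(F_L)`: column vectors over `F_L`, on which `T_n` acts
from the left by `b · w = b w` (and `T_n^t` trivially). -/
noncomputable def VL : RepCat (GLn k FR FL n).total where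
  V := FGModuleCat.of k (Fin n → FL)
  ρ A :=
    { toFun g := mulVecEnd k A FL n ((upper n (A ⊗[k] FL)).subtype g.2 : GL (Fin n) (A ⊗[k] FL))
      map_one' := by
        refine LinearMap.ext fun x => ?_
        apply (TensorProduct.piRight k A A (fun _ : Fin n => FL)).injective
        rw [piRight_mulVecEnd]
        exact Matrix.one_mulVec _
      map_mul' g h := by
        refine LinearMap.ext fun x => ?_
        apply (TensorProduct.piRight k A A (fun _ : Fin n => FL)).injective
        rw [Module.End.mul_apply, piRight_mulVecEnd, piRight_mulVecEnd, piRight_mulVecEnd,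
          Matrix.mulVec_mulVec]
        rfl }
  natural {A B} f g x := by
    apply (TensorProduct.piRight k B B (fun _ : Fin n => FL)).injective
    ext i
    refine (piRight_rTensor f.hom _ i).trans ?_
    refine (congrArg _ (congrFun (piRight_mulVecEnd _ x) i)).trans ?_
    refine Eq.trans ?_ (congrFun (piRight_mulVecEnd _ _) i).symm
    simp only [Matrix.mulVec, dotProduct, map_sum, map_mul]
    refine Finset.sum_congr rfl fun j _ => congrArg₂ _ rfl (piRight_rTensor f.hom _ j).symm

/-- The right affine semispace `V_R = T^{(n)}(F_R)`: row vectors over `F_R`, on which `T_n^t` acts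
from the right by `v · a = v a` (and `T_n` trivially). -/
noncomputable def VR : RepCat (GLn k FR FL n).total where
  V := FGModuleCat.of k (Fin n → FR)
  ρ A :=
    { toFun g := vecMulEnd k A FR n
        ((lower n (A ⊗[k] FR)).subtype g.1.unop : GL (Fin n) (A ⊗[k] FR))
      map_one' := by
        refine LinearMap.ext fun x => ?_
        apply (TensorProduct.piRight k A A (fun _ : Fin n => FR)).injective
        rw [piRight_vecMulEnd]
        exact Matrix.vecMul_one _
      map_mul' g h := by
        refine LinearMap.ext fun x => ?_
        apply (TensorProduct.piRight k A A (fun _ : Fin n => FR)).injective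
        rw [Module.End.mul_apply, piRight_vecMulEnd, piRight_vecMulEnd, piRight_vecMulEnd,
          Matrix.vecMul_vecMul]
        rfl }
  natural {A B} f g x := by
    apply (TensorProduct.piRight k B B (fun _ : Fin n => FR)).injective
    ext i
    refine (piRight_rTensor f.hom _ i).trans ?_
    refine (congrArg _ (congrFun (piRight_vecMulEnd _ x) i)).trans ?_
    refine Eq.trans ?_ (congrFun (piRight_vecMulEnd _ _) i).symm
    simp only [Matrix.vecMul, dotProduct, map_sum, map_mul]
    refine Finset.sum_congr rfl fun j _ => congrArg₂ _ (piRight_rTensor f.hom _ j).symm rfl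

/-- The `GL_n(F_R × F_L)`-bisemimodule `G^{(n)}(F_R × F_L) = V_R ⊗ V_L`. -/
noncomputable def Gn : RepCat (GLn k FR FL n).total :=
  VR k FR FL n ⊗ VL k FR FL n

/-- The action of the `A`-valued points of `GL_n(F_R × F_L)` on `A ⊗ (V_R ⊗ V_L)`. -/
noncomputable def act (A : CommAlgCat.{u} k) (g : (GLn k FR FL n).total.obj A) :
    Module.End A (A ⊗[k] Bisemispace k FR FL n) :=
  (Gn k FR FL n).ρ A g

end Bisemimodule

/-! ### Neutral Tannakian categories -/

/-- A neutral Tannakian category over a field `k`: a `k`-linear rigid abelian symmetric monoidal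
category with bilinear tensor product and `End(𝟙) = k`, together with an exact faithful `k`-linear
tensor functor (the fibre functor) to finite-dimensional `k`-vector spaces. -/
structure NeutralTannakianCategory (k : Type u) [Field k] where
  /-- the objects -/
  C : Type (u + 1)
  [category : Category.{u} C]
  [abelian : Abelian C]
  [linear : Linear k C]
  [monoidal : MonoidalCategory C]
  [symmetric : SymmetricCategory C]
  [monoidalPreadditive : MonoidalPreadditive C]
  [monoidalLinear : MonoidalLinear k C]
  [rigid : RigidCategory C]
  end_unit : Function.Bijective (fun c : k => c • 𝟙 (𝟙_ C))
  /-- the fibre functor -/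
  fiber : C ⥤ FGModuleCat.{u} k
  [fiberBraided : fiber.Braided]
  [fiberAdditive : fiber.Additive]
  [fiberLinear : fiber.Linear k]
  [fiberFaithful : fiber.Faithful]
  [fiberPreservesFiniteLimits : Limits.PreservesFiniteLimits fiber]
  [fiberPreservesFiniteColimits : Limits.PreservesFiniteColimits fiber]

attribute [instance] NeutralTannakianCategory.category NeutralTannakianCategory.abelian
  NeutralTannakianCategory.linear NeutralTannakianCategory.monoidal
  NeutralTannakianCategory.symmetric NeutralTannakianCategory.fiberBraided

/-- An equivalence of a neutral Tannakian category with the category of finite-dimensional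
representations of a group functor: a `k`-linear tensor equivalence carrying the fibre functor to
the forgetful functor, up to isomorphism of tensor functors. -/
structure TannakianEquivalence {k : Type u} [Field k] (T : NeutralTannakianCategory k)
    (G : GroupFunctor k) where
  /-- the underlying equivalence of categories -/
  equiv : T.C ≌ RepCat G
  [braided : equiv.functor.Braided]
  [additive : equiv.functor.Additive]
  [linear : equiv.functor.Linear k]
  /-- compatibility with the fibre functors -/
  fiberIso : equiv.functor ⋙ RepCat.forget G ≅ T.fiber
  [fiberIsoMonoidal : NatTrans.IsMonoidal fiberIso.hom]

end Bisemi

/-!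
Three independent facts make up the theorem.

*Affineness.* Fix a `k`-basis of `F`. A point of `T_n(A ⊗ F)` is a pair of mutually inverse
matrices over `A ⊗ F`, the first with prescribed zeros, and the coordinates of their entries form a
point of affine space over `k` satisfying polynomial equations that do not depend on `A`
(Weil restriction). The quotient of the polynomial ring by these equations, `CoordRing`, carries a
universal matrix, and `existsUnique_map_universalMatrix` is the universal property.

*The bisemimodule.* Coordinates identify `F_Rⁿ ⊗ F_Lⁿ` with `(F_R ⊗ F_L)^(n × n)` compatibly with
scalars (`bisemispaceEquiv_scalar`), and row-vector and column-vector multiplication commute with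
scalars (`act_scalar`).

*The Tannakian category.* For every group functor `G`, representable or not, the category `RepCat G`
is itself neutral Tannakian with the forgetful functor as fibre functor, so the equivalence may be
taken to be the identity. It is abelian because base change `A ⊗ -` from a field is exact: kernels
and cokernels of equivariant maps inherit an action (`exists_injective_exact`,
`exists_surjective_exact`), and an exact pair is a categorical kernel or cokernel both of
representations and of vector spaces, which also gives exactness of the forgetful functor.
Duals are contragredient representations: `g` acts on `A ⊗ V*` by the transpose of `g⁻¹`, and
evaluation and coevaluation are equivariant (`contractLeft_pairEnd`, `coevaluation_pairEnd`). The
forgetful functor being faithful and monoidal, the triangle identities are those of vector spaces.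
-/

namespace Bisemi

/-! ### Representability of triangular groups over a finite extension -/

section Affine

variable {k : Type u} [Field k] {F : Type u} [CommRing F] [Algebra k F]
variable {ι : Type u} (e : Module.Basis ι k F)

lemma baseChange_repr_map {A B : Type*} [CommRing A] [Algebra k A] [CommRing B] [Algebra k B]
    (f : A →ₐ[k] B) (z : A ⊗[k] F) (i : ι) :
    (e.baseChange B).repr (Algebra.TensorProduct.map f (AlgHom.id k F) z) i =
      f ((e.baseChange A).repr z i) := by
  induction z using TensorProduct.induction_on with
  | zero => simp
  | add x y hx hy => simp [hx, hy]
  | tmul a v => simp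

lemma map_eq_zero_iff_repr {A B : Type*} [CommRing A] [Algebra k A] [CommRing B] [Algebra k B]
    (f : A →ₐ[k] B) (z : A ⊗[k] F) :
    Algebra.TensorProduct.map f (AlgHom.id k F) z = 0 ↔
      ∀ i, f ((e.baseChange A).repr z i) = 0 := by
  rw [← (e.baseChange B).repr.map_eq_zero_iff, Finsupp.ext_iff]
  simp [baseChange_repr_map]

variable [Fintype ι] (n : ℕ)

/-- The coordinate ring of pairs of `n × n` matrices over `F`, viewed over `k`: one variable for
each coordinate, in the basis of `F`, of each entry of the two matrices. -/
abbrev PairRing (k ι : Type u) [Field k] (n : ℕ) : Type u :=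
  MvPolynomial ((Bool × Fin n × Fin n) × ι) k

/-- The two generic matrices over `F`. -/
noncomputable def genericMatrix (s : Bool) :
    Matrix (Fin n) (Fin n) (PairRing k ι n ⊗[k] F) := fun a b =>
  ∑ i, (MvPolynomial.X ((s, a, b), i) : PairRing k ι n) ⊗ₜ[k] e i

/-- The conditions that the two generic matrices are mutually inverse and that the first one
vanishes at the positions in `Z`. -/
def relations (Z : Fin n → Fin n → Prop) : Set (PairRing k ι n ⊗[k] F) :=
  {z | ∃ a b, z = (genericMatrix e n true * genericMatrix e n false - 1) a b} ∪
  {z | ∃ a b, z = (genericMatrix e n false * genericMatrix e n true - 1) a b} ∪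
  {z | ∃ a b, Z a b ∧ z = genericMatrix e n true a b}

/-- The ideal generated by all coordinates of `relations`. -/
noncomputable def relationIdeal (Z : Fin n → Fin n → Prop) : Ideal (PairRing k ι n) :=
  Ideal.span {p | ∃ z ∈ relations e n Z, ∃ i, p = (e.baseChange (PairRing k ι n)).repr z i}

/-- The coordinate ring over `k` of the invertible `n × n` matrices over `F` which vanish at the
positions in `Z`. -/
abbrev CoordRing (Z : Fin n → Fin n → Prop) : Type u := PairRing k ι n ⧸ relationIdeal e n Z

variable {n}

/-- Change of scalars along a homomorphism of `k`-algebras, `A ⊗ F → B ⊗ F`. -/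
noncomputable abbrev scalarMap (F : Type u) [CommRing F] [Algebra k F]
    {A B : Type u} [CommRing A] [Algebra k A] [CommRing B]
    [Algebra k B] (f : A →ₐ[k] B) : A ⊗[k] F →+* B ⊗[k] F :=
  (Algebra.TensorProduct.map f (AlgHom.id k F)).toRingHom

/-- A homomorphism kills the relations exactly when it sends the two generic matrices to mutually
inverse matrices, the first of which vanishes on `Z`: the coordinates of an element of `A ⊗ F`
commute with change of scalars. -/
lemma forall_mem_relationIdeal_eq_zero_iff (Z : Fin n → Fin n → Prop) {A : Type u}
    [CommRing A] [Algebra k A] (f : PairRing k ι n →ₐ[k] A) :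
    (∀ p ∈ relationIdeal e n Z, f p = 0) ↔
      (genericMatrix e n true).map (scalarMap F f) * (genericMatrix e n false).map (scalarMap F f)
        = 1 ∧
      (genericMatrix e n false).map (scalarMap F f) * (genericMatrix e n true).map (scalarMap F f)
        = 1 ∧
      ∀ a b, Z a b → scalarMap F f (genericMatrix e n true a b) = 0 := by
  have h1 : (∀ p ∈ relationIdeal e n Z, f p = 0) ↔
      ∀ z ∈ relations e n Z, scalarMap F f z = 0 := by
    have : (∀ p ∈ relationIdeal e n Z, f p = 0) ↔ relationIdeal e n Z ≤ RingHom.ker f :=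
      Iff.rfl
    rw [this, relationIdeal, Ideal.span_le]
    constructor
    · intro h z hz
      exact (map_eq_zero_iff_repr e f z).2 fun i => h ⟨z, hz, i, rfl⟩
    · rintro h _ ⟨z, hz, i, rfl⟩
      exact (map_eq_zero_iff_repr e f z).1 (h z hz) i
  have h2 (M N : Matrix (Fin n) (Fin n) (PairRing k ι n ⊗[k] F)) :
      M.map (scalarMap F f) * N.map (scalarMap F f) = 1 ↔
        ∀ a b, scalarMap F f ((M * N - 1) a b) = 0 := by
    rw [← Matrix.map_mul, ← sub_eq_zero,
      ← Matrix.map_one (scalarMap F f) (map_zero _) (map_one _),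
      ← Matrix.map_sub _ (map_sub _), ← Matrix.ext_iff]
    rfl
  rw [h1, h2, h2]
  constructor
  · intro h
    exact ⟨fun a b => h _ (Or.inl (Or.inl ⟨a, b, rfl⟩)),
      fun a b => h _ (Or.inl (Or.inr ⟨a, b, rfl⟩)), fun a b hz => h _ (Or.inr ⟨a, b, hz, rfl⟩)⟩
  · rintro ⟨h, h', h''⟩ z ((⟨a, b, rfl⟩ | ⟨a, b, rfl⟩) | ⟨a, b, hz, rfl⟩)
    exacts [h a b, h' a b, h'' a b hz]

lemma scalarMap_comp {A B C : Type u} [CommRing A] [Algebra k A] [CommRing B]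
    [Algebra k B] [CommRing C] [Algebra k C] (g : B →ₐ[k] C) (f : A →ₐ[k] B) (x : A ⊗[k] F) :
    scalarMap F (g.comp f) x = scalarMap F g (scalarMap F f x) := by
  induction x using TensorProduct.induction_on with
  | zero => simp
  | add x y hx hy => rw [map_add, map_add, map_add, hx, hy]
  | tmul a v => simp [scalarMap]

/-- The universal matrix over the coordinate ring. -/
noncomputable def universalMatrix (Z : Fin n → Fin n → Prop) :
    GL (Fin n) (CoordRing e n Z ⊗[k] F) where
  val := (genericMatrix e n true).map (scalarMap F (Ideal.Quotient.mkₐ k (relationIdeal e n Z)))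
  inv := (genericMatrix e n false).map (scalarMap F (Ideal.Quotient.mkₐ k (relationIdeal e n Z)))
  val_inv := ((forall_mem_relationIdeal_eq_zero_iff e Z (Ideal.Quotient.mkₐ k _)).1 fun _ hp =>
    Ideal.Quotient.eq_zero_iff_mem.2 hp).1
  inv_val := ((forall_mem_relationIdeal_eq_zero_iff e Z (Ideal.Quotient.mkₐ k _)).1 fun _ hp =>
    Ideal.Quotient.eq_zero_iff_mem.2 hp).2.1

lemma universalMatrix_apply_eq_zero (Z : Fin n → Fin n → Prop) {a b : Fin n} (h : Z a b) :
    (universalMatrix e Z).val a b = 0 :=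
  ((forall_mem_relationIdeal_eq_zero_iff e Z (Ideal.Quotient.mkₐ k _)).1 fun _ hp =>
    Ideal.Quotient.eq_zero_iff_mem.2 hp).2.2 a b h

lemma scalarMap_genericMatrix {A : Type u} [CommRing A] [Algebra k A]
    (f : PairRing k ι n →ₐ[k] A) (s : Bool) (a b : Fin n) :
    scalarMap F f (genericMatrix e n s a b) =
      ∑ i, f (MvPolynomial.X ((s, a, b), i)) • e.baseChange A i := by
  simp [genericMatrix, scalarMap, TensorProduct.smul_tmul']

/-- The universal property of the coordinate ring: every invertible matrix over `A ⊗ F` vanishing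
at the positions in `Z` is the image of the universal one under a unique homomorphism. -/
lemma existsUnique_map_universalMatrix (Z : Fin n → Fin n → Prop) {A : Type u} [CommRing A]
    [Algebra k A] (g : GL (Fin n) (A ⊗[k] F)) (hg : ∀ a b, Z a b → g.val a b = 0) :
    ∃! f : CoordRing e n Z →ₐ[k] A,
      Matrix.GeneralLinearGroup.map (scalarMap F f) (universalMatrix e Z) = g := by
  -- `g` and its inverse determine the values of all variables
  let M : Bool → Matrix (Fin n) (Fin n) (A ⊗[k] F) := fun s => bif s then g.val else g.inv
  let f₀ : PairRing k ι n →ₐ[k] A :=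
    MvPolynomial.aeval fun x => (e.baseChange A).repr (M x.1.1 x.1.2.1 x.1.2.2) x.2
  have hf₀ (s : Bool) : (genericMatrix e n s).map (scalarMap F f₀) = M s := by
    ext a b
    rw [Matrix.map_apply, scalarMap_genericMatrix]
    simpa [f₀] using (e.baseChange A).sum_repr (M s a b)
  have hker : ∀ p ∈ relationIdeal e n Z, f₀ p = 0 := by
    refine (forall_mem_relationIdeal_eq_zero_iff e Z f₀).2 ⟨?_, ?_, fun a b hz => ?_⟩
    · rw [hf₀, hf₀]; exact g.val_inv
    · rw [hf₀, hf₀]; exact g.inv_val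
    · exact (congrFun (congrFun (hf₀ true) a) b).trans (hg a b hz)
  refine ⟨Ideal.Quotient.liftₐ _ f₀ hker, ?_, fun f hf => ?_⟩
  · ext a b
    change scalarMap F _ (scalarMap F _ (genericMatrix e n true a b)) = _
    rw [← scalarMap_comp, Ideal.Quotient.liftₐ_comp]
    exact congrFun (congrFun (hf₀ true) a) b
  · apply Ideal.Quotient.algHom_ext
    rw [Ideal.Quotient.liftₐ_comp]
    have hM (s : Bool) :
        (genericMatrix e n s).map (scalarMap F (f.comp (Ideal.Quotient.mkₐ k _))) = M s := by
      ext a b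
      rw [Matrix.map_apply, scalarMap_comp]
      cases s
      · exact congrFun (congrFun (congrArg (fun h : GL (Fin n) (A ⊗[k] F) => h.inv) hf) a) b
      · exact congrFun (congrFun (congrArg (fun h : GL (Fin n) (A ⊗[k] F) => h.val) hf) a) b
    refine MvPolynomial.algHom_ext fun x => ?_
    obtain ⟨⟨s, a, b⟩, i⟩ := x
    have h := congrFun (congrFun (hM s) a) b
    rw [Matrix.map_apply, scalarMap_genericMatrix] at h
    have h' := congrArg (fun z => (e.baseChange A).repr z i) h
    simp only [Module.Basis.repr_sum_self] at h'
    simpa [f₀] using h'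

/-- A functor whose points are naturally the invertible matrices over `A ⊗ F` with prescribed zeros
is representable. The zeros are imposed on the matrix only and not on its inverse, which it
determines. -/
lemma isCorepresentable_of_zeroPattern [FiniteDimensional k F] (Z : Fin n → Fin n → Prop)
    (G : CommAlgCat.{u} k ⥤ Type u)
    (φ : ∀ A : CommAlgCat.{u} k,
      G.obj A ≃ {g : GL (Fin n) (A ⊗[k] F) // ∀ a b, Z a b → g.val a b = 0})
    (hφ : ∀ {A B : CommAlgCat.{u} k} (f : A ⟶ B) (x : G.obj A),
      (φ B (G.map f x)).1 = Matrix.GeneralLinearGroup.map (scalarMap F f.hom) (φ A x).1) :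
    G.IsCorepresentable := by
  obtain ⟨ι, _, e⟩ : ∃ (ι : Type u) (_ : Fintype ι), Nonempty (Module.Basis ι k F) :=
    ⟨_, inferInstance, ⟨Module.Free.chooseBasis k F⟩⟩
  obtain ⟨e⟩ := e
  let R : CommAlgCat.{u} k := CommAlgCat.of k (CoordRing e n Z)
  let x : G.obj R := (φ R).symm ⟨universalMatrix e Z, fun a b => universalMatrix_apply_eq_zero e Z⟩
  have hx {A : CommAlgCat.{u} k} (f : R ⟶ A) :
      (φ A (G.map f x)).1 =
        Matrix.GeneralLinearGroup.map (scalarMap F f.hom) (universalMatrix e Z) := by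
    rw [hφ, Equiv.apply_symm_apply]
  refine ⟨R, ⟨⟨fun {A} => Equiv.ofBijective (fun f : R ⟶ A => G.map f x)
    ⟨fun f f' h => ?_, fun y => ?_⟩, fun g f => ?_⟩⟩⟩
  · obtain ⟨_, _, hu⟩ := existsUnique_map_universalMatrix e Z (φ A (G.map f x)).1 (φ A _).2
    apply CommAlgCat.hom_ext
    rw [hu f.hom (hx f).symm, hu f'.hom ((hx f').symm.trans (congrArg (fun y => (φ A y).1) h.symm))]
  · obtain ⟨f, hf, _⟩ := existsUnique_map_universalMatrix e Z (φ A y).1 (φ A y).2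
    exact ⟨CommAlgCat.ofHom f, (φ A).injective (Subtype.ext ((hx _).trans hf))⟩
  · exact congrArg (fun h => h x) (G.map_comp f g)

lemma isAffine_upperFunctor [FiniteDimensional k F] : (upperFunctor k F n).IsAffine :=
  isCorepresentable_of_zeroPattern (F := F) (fun a b => b < a) _
    (fun _ => Equiv.subtypeEquivRight fun _ => ⟨fun h _ _ hab => h hab, fun h _ _ hab => h _ _ hab⟩)
    fun _ _ => rfl

lemma isAffine_lowerFunctor [FiniteDimensional k F] : (lowerFunctor k F n).IsAffine :=
  isCorepresentable_of_zeroPattern (F := F) (fun a b => a < b) _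
    (fun _ => Equiv.subtypeEquivRight fun _ => ⟨fun h _ _ hab => h hab, fun h _ _ hab => h _ _ hab⟩)
    fun _ _ => rfl

end Affine

/-! ### The bisemimodule structure -/

section Bisemispace

variable (k FR FL : Type u) [Field k] [Field FR] [Algebra k FR] [Field FL] [Algebra k FL] (n : ℕ)

/-- Coordinates of `F_Rⁿ ⊗ F_Lⁿ` with values in `F_R ⊗ F_L`. -/
noncomputable def bisemispaceEquiv :
    Bisemispace k FR FL n ≃ₗ[k] (Fin n → Fin n → FR ⊗[k] FL) :=
  (TensorProduct.comm k _ _).trans <|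
    (TensorProduct.piRight k k (Fin n → FL) (fun _ : Fin n => FR)).trans <|
      LinearEquiv.piCongrRight fun _ =>
        (TensorProduct.comm k _ _).trans (TensorProduct.piRight k k FR (fun _ : Fin n => FL))

lemma bisemispaceEquiv_tmul (v : Fin n → FR) (w : Fin n → FL) (i j : Fin n) :
    bisemispaceEquiv k FR FL n (v ⊗ₜ w) i j = v i ⊗ₜ w j := by
  simp [bisemispaceEquiv]

lemma bisemispaceEquiv_scalar (s : FR ⊗[k] FL) (x : Bisemispace k FR FL n) :
    bisemispaceEquiv k FR FL n (scalar k FR FL n s x) =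
      s • bisemispaceEquiv k FR FL n x := by
  induction s using TensorProduct.induction_on with
  | zero => simp
  | add s t hs ht => rw [map_add, LinearMap.add_apply, map_add, hs, ht, add_smul]
  | tmul a b =>
    induction x using TensorProduct.induction_on with
    | zero => simp
    | add x y hx hy => rw [map_add, map_add, hx, hy, map_add, smul_add]
    | tmul v w =>
      ext i j
      simp [scalar_tmul, bisemispaceEquiv_tmul]

lemma free_bisemispace :
    letI := bisemispaceModule k FR FL n
    Module.Free (FR ⊗[k] FL) (Bisemispace k FR FL n) ∧
      Module.finrank (FR ⊗[k] FL) (Bisemispace k FR FL n) = n ^ 2 := by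
  let := bisemispaceModule k FR FL n
  let E : Bisemispace k FR FL n ≃ₗ[FR ⊗[k] FL] (Fin n → Fin n → FR ⊗[k] FL) :=
    { bisemispaceEquiv k FR FL n with map_smul' := bisemispaceEquiv_scalar k FR FL n }
  refine ⟨Module.Free.of_equiv E.symm, ?_⟩
  rw [E.finrank_eq]
  simp [Module.finrank_pi_fintype, sq]

end Bisemispace

section Action

variable (k FR FL : Type u) [Field k] [Field FR] [Algebra k FR] [Field FL] [Algebra k FL] (n : ℕ)

lemma vecMulEnd_one_tmul (A : Type u) [CommRing A] [Algebra k A]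
    (M : Matrix (Fin n) (Fin n) FR) (v : Fin n → FR) :
    vecMulEnd k A FR n
        (M.map (Algebra.TensorProduct.includeRight : FR →ₐ[k] A ⊗[k] FR)) (1 ⊗ₜ v) =
      1 ⊗ₜ Matrix.vecMul v M := by
  apply (TensorProduct.piRight k A A (fun _ : Fin n => FR)).injective
  rw [piRight_vecMulEnd]
  ext i
  simp [Matrix.vecMul, dotProduct, TensorProduct.tmul_sum]

lemma mulVecEnd_one_tmul (A : Type u) [CommRing A] [Algebra k A]
    (M : Matrix (Fin n) (Fin n) FL) (v : Fin n → FL) :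
    mulVecEnd k A FL n
        (M.map (Algebra.TensorProduct.includeRight : FL →ₐ[k] A ⊗[k] FL)) (1 ⊗ₜ v) =
      1 ⊗ₜ Matrix.mulVec M v := by
  apply (TensorProduct.piRight k A A (fun _ : Fin n => FL)).injective
  rw [piRight_mulVecEnd]
  ext i
  simp [Matrix.mulVec, dotProduct, TensorProduct.tmul_sum]

variable {k FR FL n}

lemma piRight_baseChange_lsmul {F A : Type u} [CommRing F] [Algebra k F] [CommRing A] [Algebra k A]
    (s : F) (x : A ⊗[k] (Fin n → F)) :
    TensorProduct.piRight k A A (fun _ : Fin n => F)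
        ((Algebra.lsmul k k (Fin n → F) s).baseChange A x) =
      ((1 : A) ⊗ₜ[k] s) • TensorProduct.piRight k A A (fun _ : Fin n => F) x := by
  induction x using TensorProduct.induction_on with
  | zero => simp
  | add x y hx hy => rw [map_add, map_add, hx, hy, map_add, smul_add]
  | tmul a v => ext i; simp

lemma vecMulEnd_baseChange_lsmul {F A : Type u} [CommRing F] [Algebra k F] [CommRing A]
    [Algebra k A] (M : Matrix (Fin n) (Fin n) (A ⊗[k] F)) (s : F) (x : A ⊗[k] (Fin n → F)) :
    (Algebra.lsmul k k (Fin n → F) s).baseChange A (vecMulEnd k A F n M x) =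
      vecMulEnd k A F n M ((Algebra.lsmul k k (Fin n → F) s).baseChange A x) := by
  apply (TensorProduct.piRight k A A (fun _ : Fin n => F)).injective
  rw [piRight_vecMulEnd, piRight_baseChange_lsmul, piRight_baseChange_lsmul, piRight_vecMulEnd,
    Matrix.smul_vecMul]

lemma mulVecEnd_baseChange_lsmul {F A : Type u} [CommRing F] [Algebra k F] [CommRing A]
    [Algebra k A] (M : Matrix (Fin n) (Fin n) (A ⊗[k] F)) (s : F) (x : A ⊗[k] (Fin n → F)) :
    (Algebra.lsmul k k (Fin n → F) s).baseChange A (mulVecEnd k A F n M x) =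
      mulVecEnd k A F n M ((Algebra.lsmul k k (Fin n → F) s).baseChange A x) := by
  apply (TensorProduct.piRight k A A (fun _ : Fin n => F)).injective
  rw [piRight_mulVecEnd, piRight_baseChange_lsmul, piRight_baseChange_lsmul, piRight_mulVecEnd,
    Matrix.mulVec_smul]

variable (k FR FL n) [FiniteDimensional k FR] [FiniteDimensional k FL]

lemma act_eq_pairEnd (A : CommAlgCat.{u} k) (g : (GLn k FR FL n).total.obj A) :
    act k FR FL n A g = pairEnd A
      (vecMulEnd k A FR n ((lower n (A ⊗[k] FR)).subtype g.1.unop : GL (Fin n) (A ⊗[k] FR)).val)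
      (mulVecEnd k A FL n ((upper n (A ⊗[k] FL)).subtype g.2 : GL (Fin n) (A ⊗[k] FL)).val) :=
  rfl

lemma act_point_one_tmul (A : CommAlgCat.{u} k) (a : lower n FR) (b : upper n FL)
    (v : Fin n → FR) (w : Fin n → FL) :
    act k FR FL n A (point k FR FL n A a b) (1 ⊗ₜ[k] (v ⊗ₜ[k] w)) =
      1 ⊗ₜ[k] (Matrix.vecMul v (a : GL (Fin n) FR).val ⊗ₜ[k]
        Matrix.mulVec (b : GL (Fin n) FL).val w) := by
  have h : (1 : A) ⊗ₜ[k] (v ⊗ₜ[k] w) = pair (A : Type u) (1 ⊗ₜ v) (1 ⊗ₜ w) := by simp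
  rw [act_eq_pairEnd, h, pairEnd_pair]
  refine (congrArg₂ _ (vecMulEnd_one_tmul k FR n A _ v)
    (mulVecEnd_one_tmul k FL n A _ w)).trans ?_
  rw [pair_tmul, one_mul]
  rfl

lemma act_scalar (A : CommAlgCat.{u} k) (g : (GLn k FR FL n).total.obj A) (s : FR ⊗[k] FL)
    (x : A ⊗[k] Bisemispace k FR FL n) :
    act k FR FL n A g ((scalar k FR FL n s).baseChange A x) =
      (scalar k FR FL n s).baseChange A (act k FR FL n A g x) := by
  induction s using TensorProduct.induction_on with
  | zero => simp
  | add s t hs ht =>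
    rw [map_add, LinearMap.baseChange_add, LinearMap.add_apply, LinearMap.add_apply, map_add,
      hs, ht]
  | tmul a b =>
    rw [act_eq_pairEnd]
    exact (map_pairEnd A (Algebra.lsmul k k (Fin n → FR) a) (Algebra.lsmul k k (Fin n → FL) b)
      (vecMulEnd_baseChange_lsmul _ a) (mulVecEnd_baseChange_lsmul _ b) x).symm

end Action

/-! ### Exactness for finite-dimensional vector spaces -/

section Exact

open Limits

variable {k : Type u} [Field k]

section BaseChange

variable {V W U : Type*} [AddCommGroup V] [Module k V] [AddCommGroup W] [Module k W]
  [AddCommGroup U] [Module k U] (A : Type*) [CommRing A] [Algebra k A]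

lemma baseChange_injective {f : V →ₗ[k] W} (hf : Function.Injective f) :
    Function.Injective (f.baseChange A) :=
  Module.Flat.lTensor_preserves_injective_linearMap (M := A) f hf

lemma baseChange_surjective {f : V →ₗ[k] W} (hf : Function.Surjective f) :
    Function.Surjective (f.baseChange A) :=
  LinearMap.lTensor_surjective A hf

lemma baseChange_exact {f : V →ₗ[k] W} {g : W →ₗ[k] U} (h : Function.Exact f g) :
    Function.Exact (f.baseChange A) (g.baseChange A) :=
  Module.Flat.lTensor_exact A h

lemma baseChange_comp_apply (f : V →ₗ[k] W) (g : W →ₗ[k] U) (x : A ⊗[k] V) :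
    (g ∘ₗ f).baseChange A x = g.baseChange A (f.baseChange A x) := by
  rw [LinearMap.baseChange_comp, LinearMap.comp_apply]

lemma rTensor_baseChange {B : Type*} [CommRing B] [Algebra k B] (φ : A →ₐ[k] B) (f : V →ₗ[k] W)
    (x : A ⊗[k] V) :
    φ.toLinearMap.rTensor W (f.baseChange A x) =
      f.baseChange B (φ.toLinearMap.rTensor V x) := by
  induction x using TensorProduct.induction_on with
  | zero => simp
  | add x y hx hy => simp only [map_add, hx, hy]
  | tmul a v => simp

/-- A linear map killed by `g` factors through an injection whose image is the kernel of `g`. -/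
lemma exists_comp_eq_of_exact {Z : Type*} [AddCommGroup Z] [Module k Z] {i : W →ₗ[k] V}
    {g : V →ₗ[k] U} (hi : Function.Injective i) (hex : Function.Exact i g) (h : Z →ₗ[k] V)
    (hgh : g ∘ₗ h = 0) : ∃ l : Z →ₗ[k] W, i ∘ₗ l = h := by
  obtain ⟨r, hr⟩ := i.exists_leftInverse_of_injective (LinearMap.ker_eq_bot.2 hi)
  refine ⟨r ∘ₗ h, LinearMap.ext fun z => ?_⟩
  obtain ⟨w, hw⟩ := (hex (h z)).1 (LinearMap.congr_fun hgh z)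
  have hrw : r (i w) = w := LinearMap.congr_fun hr w
  simp [← hw, hrw]

/-- A linear map killing the image of `g` factors through a surjection whose kernel is that
image. -/
lemma exists_eq_comp_of_exact {Z : Type*} [AddCommGroup Z] [Module k Z] {p : V →ₗ[k] W}
    {g : U →ₗ[k] V} (hp : Function.Surjective p) (hex : Function.Exact g p) (h : V →ₗ[k] Z)
    (hgh : h ∘ₗ g = 0) : ∃ l : W →ₗ[k] Z, l ∘ₗ p = h := by
  obtain ⟨s, hs⟩ := p.exists_rightInverse_of_surjective (LinearMap.range_eq_top.2 hp)
  refine ⟨h ∘ₗ s, LinearMap.ext fun v => ?_⟩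
  have hps : p (s (p v)) = p v := LinearMap.congr_fun hs (p v)
  obtain ⟨w, hw⟩ := (hex (s (p v) - v)).1 (by rw [map_sub, hps, sub_self])
  have := LinearMap.congr_fun hgh w
  rw [LinearMap.comp_apply, hw, map_sub] at this
  exact sub_eq_zero.1 this

end BaseChange

section PiEnd

variable {n : ℕ} {V : Fin n → Type*} [∀ j, AddCommGroup (V j)] [∀ j, Module k (V j)]
variable (A : Type*) [CommRing A] [Algebra k A]

lemma baseChange_proj_ext {x y : A ⊗[k] (∀ j, V j)}
    (h : ∀ j, (LinearMap.proj (R := k) (φ := V) j).baseChange A x =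
      (LinearMap.proj (R := k) (φ := V) j).baseChange A y) : x = y := by
  have hp (z : A ⊗[k] (∀ j, V j)) (j) : TensorProduct.piRight k A A V z j =
      (LinearMap.proj (R := k) (φ := V) j).baseChange A z := by
    induction z using TensorProduct.induction_on with
    | zero => simp
    | add x y hx hy => simp only [map_add, Pi.add_apply, hx, hy]
    | tmul a v => simp
  apply (TensorProduct.piRight k A A V).injective
  ext j
  rw [hp, hp, h]

/-- The endomorphism of `A ⊗ ∏ V_j` which is diagonal with given endomorphisms of the
`A ⊗ V_j`. -/
noncomputable def piEnd (T : ∀ j, Module.End A (A ⊗[k] V j)) :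
    Module.End A (A ⊗[k] (∀ j, V j)) :=
  ∑ j, (LinearMap.single k V j).baseChange A ∘ₗ T j ∘ₗ
    (LinearMap.proj (R := k) (φ := V) j).baseChange A

lemma baseChange_proj_single_same (a : Fin n) (x : A ⊗[k] V a) :
    (LinearMap.proj (R := k) (φ := V) a).baseChange A
      ((LinearMap.single k V a).baseChange A x) = x := by
  rw [← baseChange_comp_apply, LinearMap.proj_comp_single_same, LinearMap.baseChange_id]
  rfl

lemma baseChange_proj_single_ne {a b : Fin n} (h : b ≠ a) (x : A ⊗[k] V a) :
    (LinearMap.proj (R := k) (φ := V) b).baseChange A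
      ((LinearMap.single k V a).baseChange A x) = 0 := by
  rw [← baseChange_comp_apply, LinearMap.proj_comp_single_ne k _ _ _ h, LinearMap.baseChange_zero]
  rfl

lemma proj_piEnd (T : ∀ j, Module.End A (A ⊗[k] V j)) (x : A ⊗[k] (∀ j, V j)) (b : Fin n) :
    (LinearMap.proj (R := k) (φ := V) b).baseChange A (piEnd A T x) =
      T b ((LinearMap.proj (R := k) (φ := V) b).baseChange A x) := by
  simp only [piEnd, LinearMap.sum_apply, LinearMap.comp_apply, map_sum]
  rw [Finset.sum_eq_single b]
  · rw [baseChange_proj_single_same]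
  · intro a _ hab
    rw [baseChange_proj_single_ne A hab.symm]
  · exact fun hb => (hb (Finset.mem_univ b)).elim

lemma piEnd_single (T : ∀ j, Module.End A (A ⊗[k] V j)) (a : Fin n) (x : A ⊗[k] V a) :
    (LinearMap.single k V a).baseChange A (T a x) =
      piEnd A T ((LinearMap.single k V a).baseChange A x) := by
  refine baseChange_proj_ext A fun b => ?_
  rw [proj_piEnd]
  obtain rfl | h := eq_or_ne b a
  · rw [baseChange_proj_single_same, baseChange_proj_single_same]
  · rw [baseChange_proj_single_ne A h, baseChange_proj_single_ne A h, map_zero]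

lemma piEnd_one : piEnd A (fun j => (1 : Module.End A (A ⊗[k] V j))) = 1 :=
  LinearMap.ext fun _ => baseChange_proj_ext A fun j => proj_piEnd A _ _ j

lemma piEnd_mul (S T : ∀ j, Module.End A (A ⊗[k] V j)) :
    piEnd A (fun j => S j * T j) = piEnd A S * piEnd A T :=
  LinearMap.ext fun _ => baseChange_proj_ext A fun j => by
    simp only [Module.End.mul_apply, proj_piEnd]

lemma rTensor_piEnd {B : Type*} [CommRing B] [Algebra k B] (f : A →ₐ[k] B)
    {S : ∀ j, Module.End A (A ⊗[k] V j)} {T : ∀ j, Module.End B (B ⊗[k] V j)}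
    (h : ∀ j x, f.toLinearMap.rTensor (V j) (S j x) = T j (f.toLinearMap.rTensor (V j) x))
    (x : A ⊗[k] (∀ j, V j)) :
    f.toLinearMap.rTensor _ (piEnd A S x) = piEnd B T (f.toLinearMap.rTensor _ x) :=
  baseChange_proj_ext B fun j => by
    rw [proj_piEnd, ← rTensor_baseChange, ← rTensor_baseChange, proj_piEnd, h]

end PiEnd

/-- The linear map underlying a morphism of finite-dimensional vector spaces. -/
abbrev fgLin {V W : FGModuleCat.{u} k} (f : V ⟶ W) : V →ₗ[k] W := f.hom.hom

lemma fgModuleCat_hom_ext {V W : FGModuleCat.{u} k} {f g : V ⟶ W} (h : fgLin f = fgLin g) :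
    f = g :=
  InducedCategory.hom_ext (ModuleCat.hom_ext h)

/-- In finite-dimensional vector spaces, an injection onto the kernel of `f` is a categorical
kernel of `f`. -/
noncomputable def isLimitOfExact {K V W : FGModuleCat.{u} k} {f : V ⟶ W} {i : K ⟶ V}
    (w : i ≫ f = 0) (hi : Function.Injective (fgLin i))
    (hex : Function.Exact (fgLin i) (fgLin f)) :
    IsLimit (KernelFork.ofι i w) :=
  KernelFork.IsLimit.ofι _ _
    (fun h hh => FGModuleCat.ofHom (exists_comp_eq_of_exact hi hex (fgLin h)
      (congrArg fgLin hh)).choose)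
    (fun h hh => fgModuleCat_hom_ext (exists_comp_eq_of_exact hi hex (fgLin h)
      (congrArg fgLin hh)).choose_spec)
    (fun h hh _ hm => fgModuleCat_hom_ext (LinearMap.ext fun x => hi
      ((LinearMap.congr_fun (congrArg fgLin hm) x).trans
        (LinearMap.congr_fun (exists_comp_eq_of_exact hi hex (fgLin h)
          (congrArg fgLin hh)).choose_spec x).symm)))

/-- In finite-dimensional vector spaces, a surjection with kernel the image of `f` is a
categorical cokernel of `f`. -/
noncomputable def isColimitOfExact {U V Q : FGModuleCat.{u} k} {f : U ⟶ V} {p : V ⟶ Q}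
    (w : f ≫ p = 0) (hp : Function.Surjective (fgLin p))
    (hex : Function.Exact (fgLin f) (fgLin p)) : IsColimit (CokernelCofork.ofπ p w) :=
  CokernelCofork.IsColimit.ofπ _ _
    (fun h hh => FGModuleCat.ofHom (exists_eq_comp_of_exact hp hex (fgLin h)
      (congrArg fgLin hh)).choose)
    (fun h hh => fgModuleCat_hom_ext (exists_eq_comp_of_exact hp hex (fgLin h)
      (congrArg fgLin hh)).choose_spec)
    (fun h hh m hm => fgModuleCat_hom_ext (LinearMap.ext fun x => by
      obtain ⟨y, rfl⟩ := hp x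
      exact (LinearMap.congr_fun (congrArg fgLin hm) y).trans
        (LinearMap.congr_fun (exists_eq_comp_of_exact hp hex (fgLin h)
          (congrArg fgLin hh)).choose_spec y).symm))

end Exact

/-! ### The abelian structure on representations -/

namespace RepCat

open Limits

variable {k : Type u} [Field k] {G : GroupFunctor k}

/-- The linear map underlying a morphism of representations. -/
abbrev lin {X Y : RepCat G} (f : X ⟶ Y) : X.V →ₗ[k] Y.V := f.hom.hom.hom

lemma lin_ext {X Y : RepCat G} {f g : X ⟶ Y} (h : lin f = lin g) : f = g :=
  hom_ext (fgModuleCat_hom_ext h)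

/-- An equivariant linear map as a morphism of representations. -/
def mkHom {X Y : RepCat G} (l : X.V →ₗ[k] Y.V)
    (h : ∀ (A : CommAlgCat.{u} k) (g : G.obj A) (x : A ⊗[k] X.V),
      l.baseChange A (X.ρ A g x) = Y.ρ A g (l.baseChange A x)) : X ⟶ Y :=
  ⟨FGModuleCat.ofHom l, h⟩

/-- A linear map into a subrepresentation is equivariant if it is so after inclusion. -/
lemma equivariant_of_comp {X Y Z : RepCat G} {i : Y ⟶ X} (hi : Function.Injective (lin i))
    (h : Z ⟶ X) {l : Z.V →ₗ[k] Y.V} (hl : lin i ∘ₗ l = lin h) (A : CommAlgCat.{u} k)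
    (g : G.obj A) (x : A ⊗[k] Z.V) :
    l.baseChange A (Z.ρ A g x) = Y.ρ A g (l.baseChange A x) := by
  apply baseChange_injective A hi
  rw [← baseChange_comp_apply, hl, i.comm, ← baseChange_comp_apply, hl, h.comm]

/-- A linear map out of a quotient representation is equivariant if it is so after projection. -/
lemma equivariant_of_comp' {X Y Z : RepCat G} {p : X ⟶ Y} (hp : Function.Surjective (lin p))
    (h : X ⟶ Z) {l : Y.V →ₗ[k] Z.V} (hl : l ∘ₗ lin p = lin h) (A : CommAlgCat.{u} k)
    (g : G.obj A) (x : A ⊗[k] Y.V) :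
    l.baseChange A (Y.ρ A g x) = Z.ρ A g (l.baseChange A x) := by
  obtain ⟨x, rfl⟩ := baseChange_surjective A hp x
  rw [← p.comm, ← baseChange_comp_apply, ← baseChange_comp_apply, hl, h.comm]

/-- An injective morphism of representations onto the kernel of `f` is a categorical kernel of
`f`. -/
noncomputable def isLimitOfExact {K X Y : RepCat G} {f : X ⟶ Y} {i : K ⟶ X} (w : i ≫ f = 0)
    (hi : Function.Injective (lin i)) (hex : Function.Exact (lin i) (lin f)) :
    IsLimit (KernelFork.ofι i w) :=
  KernelFork.IsLimit.ofι _ _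
    (fun h hh => mkHom _ (equivariant_of_comp hi h (exists_comp_eq_of_exact hi hex (lin h)
      (congrArg lin hh)).choose_spec))
    (fun h hh => lin_ext (exists_comp_eq_of_exact hi hex (lin h)
      (congrArg lin hh)).choose_spec)
    (fun h hh _ hm => lin_ext (LinearMap.ext fun x => hi
      ((LinearMap.congr_fun (congrArg lin hm) x).trans
        (LinearMap.congr_fun (exists_comp_eq_of_exact hi hex (lin h)
          (congrArg lin hh)).choose_spec x).symm)))

/-- A surjective morphism of representations with kernel the image of `f` is a categorical
cokernel of `f`. -/
noncomputable def isColimitOfExact {Y X Q : RepCat G} {f : Y ⟶ X} {p : X ⟶ Q}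
    (w : f ≫ p = 0) (hp : Function.Surjective (lin p))
    (hex : Function.Exact (lin f) (lin p)) : IsColimit (CokernelCofork.ofπ p w) :=
  CokernelCofork.IsColimit.ofπ _ _
    (fun h hh => mkHom _ (equivariant_of_comp' hp h (exists_eq_comp_of_exact hp hex (lin h)
      (congrArg lin hh)).choose_spec))
    (fun h hh => lin_ext (exists_eq_comp_of_exact hp hex (lin h)
      (congrArg lin hh)).choose_spec)
    (fun h hh m hm => lin_ext (LinearMap.ext fun x => by
      obtain ⟨y, rfl⟩ := hp x
      exact (LinearMap.congr_fun (congrArg lin hm) y).trans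
        (LinearMap.congr_fun (exists_eq_comp_of_exact hp hex (lin h)
          (congrArg lin hh)).choose_spec y).symm))

/-- The action of `G` on a linear retract `i : W → V`, `r : V → W` of a representation `V`, given
by `r ∘ ρ(g) ∘ i`; multiplicativity amounts to `r ρ(g) i r ρ(h) i = r ρ(g) ρ(h) i`. -/
noncomputable def retract (X : RepCat G) (W : FGModuleCat.{u} k) (i : W →ₗ[k] X.V)
    (r : X.V →ₗ[k] W) (hri : r ∘ₗ i = LinearMap.id)
    (hmul : ∀ (A : CommAlgCat.{u} k) (g h : G.obj A) (x : A ⊗[k] W),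
      r.baseChange A (X.ρ A g (i.baseChange A (r.baseChange A (X.ρ A h (i.baseChange A x))))) =
        r.baseChange A (X.ρ A g (X.ρ A h (i.baseChange A x)))) : RepCat G where
  V := W
  ρ A :=
    { toFun g := r.baseChange A ∘ₗ X.ρ A g ∘ₗ i.baseChange A
      map_one' := by
        rw [map_one, Module.End.one_eq_id, LinearMap.id_comp, ← LinearMap.baseChange_comp, hri,
          LinearMap.baseChange_id]
        rfl
      map_mul' g h := by
        refine LinearMap.ext fun x => ?_
        rw [map_mul]
        exact (hmul A g h x).symm }
  natural {A B} f g x := by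
    refine (rTensor_baseChange (A : Type u) f.hom r _).trans ?_
    refine congrArg _ ((X.natural f g _).trans ?_)
    exact congrArg _ (rTensor_baseChange (A : Type u) f.hom i x)

/-- Every morphism has a kernel with the expected underlying vector space. -/
lemma exists_injective_exact {X Y : RepCat G} (f : X ⟶ Y) :
    ∃ (K : RepCat G) (i : K ⟶ X), Function.Injective (lin i) ∧
      Function.Exact (lin i) (lin f) := by
  let i : LinearMap.ker (lin f) →ₗ[k] X.V := Submodule.subtype _
  have hi : Function.Injective i := Subtype.val_injective
  have hex : Function.Exact i (lin f) := LinearMap.exact_subtype_ker_map _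
  obtain ⟨r, hr⟩ := i.exists_leftInverse_of_injective (LinearMap.ker_eq_bot.2 hi)
  -- the kernel after base change is stable, being the kernel of an equivariant map
  have key (A : CommAlgCat.{u} k) (g : G.obj A) (x : A ⊗[k] LinearMap.ker (lin f)) :
      i.baseChange A (r.baseChange A (X.ρ A g (i.baseChange A x))) =
        X.ρ A g (i.baseChange A x) := by
    have h0 : (lin f).baseChange A (X.ρ A g (i.baseChange A x)) = 0 := by
      rw [f.comm, (baseChange_exact A hex).apply_apply_eq_zero, map_zero]
    obtain ⟨y, hy⟩ := (baseChange_exact A hex _).1 h0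
    rw [← hy, ← baseChange_comp_apply (A : Type u) i r, hr, LinearMap.baseChange_id]
    rfl
  refine ⟨retract X (FGModuleCat.of k (LinearMap.ker (lin f))) i r hr fun A g h x => ?_,
    mkHom i fun A g x => ?_, hi, hex⟩
  · rw [key]
  · exact key A g x

/-- Every morphism has a cokernel with the expected underlying vector space. -/
lemma exists_surjective_exact {X Y : RepCat G} (f : X ⟶ Y) :
    ∃ (Q : RepCat G) (p : Y ⟶ Q), Function.Surjective (lin p) ∧
      Function.Exact (lin f) (lin p) := by
  let p : Y.V →ₗ[k] Y.V ⧸ LinearMap.range (lin f) := Submodule.mkQ _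
  have hp : Function.Surjective p := Submodule.mkQ_surjective _
  have hex : Function.Exact (lin f) p := LinearMap.exact_map_mkQ_range _
  obtain ⟨s, hs⟩ := p.exists_rightInverse_of_surjective (LinearMap.range_eq_top.2 hp)
  -- the action descends because the image of `f` after base change is stable
  have key (A : CommAlgCat.{u} k) (g : G.obj A) (x : A ⊗[k] Y.V) :
      p.baseChange A (Y.ρ A g (s.baseChange A (p.baseChange A x))) =
        p.baseChange A (Y.ρ A g x) := by
    have h0 : p.baseChange A (s.baseChange A (p.baseChange A x) - x) = 0 := by
      rw [map_sub, ← baseChange_comp_apply (A : Type u) s p, hs, LinearMap.baseChange_id]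
      exact sub_self _
    obtain ⟨y, hy⟩ := (baseChange_exact A hex _).1 h0
    rw [← sub_eq_zero, ← map_sub, ← map_sub, ← hy, ← f.comm,
      (baseChange_exact A hex).apply_apply_eq_zero]
  refine ⟨retract Y (FGModuleCat.of k (Y.V ⧸ LinearMap.range (lin f))) s p hs
    fun A g h x => ?_, mkHom p fun A g x => ?_, hp, hex⟩
  · rw [key]
  · exact (key A g x).symm

lemma comp_eq_zero_of_exact {X Y Z : RepCat G} {f : X ⟶ Y} {g : Y ⟶ Z}
    (h : Function.Exact (lin f) (lin g)) : f ≫ g = 0 :=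
  lin_ext (LinearMap.ext h.apply_apply_eq_zero)

lemma injective_of_mono {X Y : RepCat G} (f : X ⟶ Y) [Mono f] : Function.Injective (lin f) := by
  obtain ⟨K, i, _, hex⟩ := exists_injective_exact f
  have hi0 : i = 0 := (cancel_mono f).1 ((comp_eq_zero_of_exact hex).trans zero_comp.symm)
  rw [injective_iff_map_eq_zero]
  intro x hx
  obtain ⟨y, rfl⟩ := (hex x).1 hx
  rw [hi0]
  rfl

lemma surjective_of_epi {X Y : RepCat G} (f : X ⟶ Y) [Epi f] : Function.Surjective (lin f) := by
  obtain ⟨Q, p, _, hex⟩ := exists_surjective_exact f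
  have hp0 : p = 0 := (cancel_epi f).1 ((comp_eq_zero_of_exact hex).trans comp_zero.symm)
  intro y
  refine (hex y).1 ?_
  rw [hp0]
  rfl

instance : HasKernels (RepCat G) where
  has_limit f := by
    obtain ⟨K, i, hi, hex⟩ := exists_injective_exact f
    exact ⟨⟨_, isLimitOfExact (comp_eq_zero_of_exact hex) hi hex⟩⟩

instance : HasCokernels (RepCat G) where
  has_colimit f := by
    obtain ⟨Q, p, hp, hex⟩ := exists_surjective_exact f
    exact ⟨⟨_, isColimitOfExact (comp_eq_zero_of_exact hex) hp hex⟩⟩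

instance : IsNormalMonoCategory (RepCat G) where
  normalMonoOfMono f _ := by
    obtain ⟨Q, p, hp, hex⟩ := exists_surjective_exact f
    exact ⟨⟨Q, p, comp_eq_zero_of_exact hex, isLimitOfExact _ (injective_of_mono f) hex⟩⟩

instance : IsNormalEpiCategory (RepCat G) where
  normalEpiOfEpi f _ := by
    obtain ⟨K, i, hi, hex⟩ := exists_injective_exact f
    exact ⟨⟨K, i, comp_eq_zero_of_exact hex, isColimitOfExact _ (surjective_of_epi f) hex⟩⟩

section Pi

variable {n : ℕ} (X : Fin n → RepCat G)

/-- The product of a finite family of representations. -/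
noncomputable def pi : RepCat G where
  V := FGModuleCat.of k (∀ j, (X j).V)
  ρ A :=
    { toFun g := piEnd (V := fun j => (X j).V) A fun j => (X j).ρ A g
      map_one' := by
        simp only [map_one]
        exact piEnd_one (V := fun j => (X j).V) A
      map_mul' g h := by
        simp only [map_mul]
        exact piEnd_mul (V := fun j => (X j).V) A _ _ }
  natural f g x :=
    rTensor_piEnd (V := fun j => (X j).V) _ f.hom (fun j y => (X j).natural f g y) x

/-- The projections of a product of representations. -/
noncomputable def piProj (b : Fin n) : pi X ⟶ X b :=
  mkHom (LinearMap.proj (R := k) (φ := fun j => (X j).V) b) fun A _ x =>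
    proj_piEnd (V := fun j => (X j).V) A _ x b

/-- The inclusions into a product of representations. -/
noncomputable def piSingle (a : Fin n) : X a ⟶ pi X :=
  mkHom (LinearMap.single k (fun j => (X j).V) a) fun A g x =>
    piEnd_single (V := fun j => (X j).V) A (fun j => (X j).ρ A g) a x

/-- A product of representations as a bicone. -/
noncomputable def piBicone : Bicone X where
  pt := pi X
  π := piProj X
  ι := piSingle X
  ι_π a b := by
    split_ifs with h
    · subst h
      exact lin_ext (LinearMap.proj_comp_single_same k (fun j => (X j).V) a)
    · exact lin_ext (LinearMap.proj_comp_single_ne k (fun j => (X j).V) b a (Ne.symm h))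

/-- Passing to underlying linear maps is additive. -/
def linHom (X Y : RepCat G) : (X ⟶ Y) →+ (X.V →ₗ[k] Y.V) where
  toFun := lin
  map_zero' := rfl
  map_add' _ _ := rfl

lemma piBicone_total : ∑ j, (piBicone X).π j ≫ (piBicone X).ι j = 𝟙 (piBicone X).pt :=
  lin_ext ((map_sum (linHom (pi X) (pi X)) _ _).trans
    (LinearMap.ext fun x => by
      refine (LinearMap.sum_apply _ _ _).trans ?_
      exact Finset.univ_sum_single (M := fun j => (X j).V) x))

end Pi

instance : HasFiniteBiproducts (RepCat G) where
  out _ := ⟨fun X => hasBiproduct_of_total (piBicone X) (piBicone_total X)⟩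

noncomputable instance : Abelian (RepCat G) where

instance : PreservesFiniteLimits (forget G) :=
  have {X Y : RepCat G} (f : X ⟶ Y) : PreservesLimit (parallelPair f 0) (forget G) := by
    obtain ⟨K, i, hi, hex⟩ := exists_injective_exact f
    refine preservesLimit_of_preserves_limit_cone
      (isLimitOfExact (comp_eq_zero_of_exact hex) hi hex) ?_
    exact (isLimitMapConeForkEquiv' (forget G) _).symm (Bisemi.isLimitOfExact _ hi hex)
  Functor.preservesFiniteLimits_of_preservesKernels _

instance : PreservesFiniteColimits (forget G) :=
  have {X Y : RepCat G} (f : X ⟶ Y) : PreservesColimit (parallelPair f 0) (forget G) := by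
    obtain ⟨Q, p, hp, hex⟩ := exists_surjective_exact f
    refine preservesColimit_of_preserves_colimit_cocone
      (isColimitOfExact (comp_eq_zero_of_exact hex) hp hex) ?_
    exact (isColimitMapCoconeCoforkEquiv' (forget G) _).symm (Bisemi.isColimitOfExact _ hp hex)
  Functor.preservesFiniteColimits_of_preservesCokernels _

end RepCat

/-! ### Duality after base change -/

section Contragredient

variable {k : Type*} [Field k] (A : Type*) [CommRing A] [Algebra k A]
variable {V : Type*} [AddCommGroup V] [Module k V]

/-- The `A`-bilinear evaluation pairing `(A ⊗ V*) × (A ⊗ V) → A`. -/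
noncomputable def evalPair (φ : A ⊗[k] Module.Dual k V) (x : A ⊗[k] V) : A :=
  TensorProduct.AlgebraTensorModule.rid k A A
    ((contractLeft k V).baseChange A (pair A φ x))

@[simp] lemma evalPair_tmul (a b : A) (φ : Module.Dual k V) (v : V) :
    evalPair A (a ⊗ₜ φ) (b ⊗ₜ v) = φ v • (a * b) := by
  simp [evalPair]

lemma evalPair_add_left (φ ψ : A ⊗[k] Module.Dual k V) (x : A ⊗[k] V) :
    evalPair A (φ + ψ) x = evalPair A φ x + evalPair A ψ x := by
  simp [evalPair, pair_add_left]

lemma evalPair_add_right (φ : A ⊗[k] Module.Dual k V) (x y : A ⊗[k] V) :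
    evalPair A φ (x + y) = evalPair A φ x + evalPair A φ y := by
  simp [evalPair, pair_add_right]

@[simp] lemma evalPair_zero_left (x : A ⊗[k] V) :
    evalPair A (0 : A ⊗[k] Module.Dual k V) x = 0 := by simp [evalPair]

@[simp] lemma evalPair_zero_right (φ : A ⊗[k] Module.Dual k V) :
    evalPair A φ (0 : A ⊗[k] V) = 0 := by simp [evalPair]

lemma pair_smul_left {W : Type*} [AddCommGroup W] [Module k W] (a : A) (p : A ⊗[k] V)
    (q : A ⊗[k] W) : pair A (a • p) q = a • pair A p q := by
  rw [pair, ← TensorProduct.smul_tmul', map_smul, pair]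

lemma pair_smul_right {W : Type*} [AddCommGroup W] [Module k W] (a : A) (p : A ⊗[k] V)
    (q : A ⊗[k] W) : pair A p (a • q) = a • pair A p q := by
  simp [pair]

lemma evalPair_smul_left (a : A) (φ : A ⊗[k] Module.Dual k V) (x : A ⊗[k] V) :
    evalPair A (a • φ) x = a * evalPair A φ x := by
  simp [evalPair, pair_smul_left]

lemma evalPair_smul_right (a : A) (φ : A ⊗[k] Module.Dual k V) (x : A ⊗[k] V) :
    evalPair A φ (a • x) = a * evalPair A φ x := by
  simp [evalPair, pair_smul_right]

lemma evalPair_sum_left {ι : Type*} (s : Finset ι) (φ : ι → A ⊗[k] Module.Dual k V)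
    (x : A ⊗[k] V) : evalPair A (∑ i ∈ s, φ i) x = ∑ i ∈ s, evalPair A (φ i) x :=
  map_sum (AddMonoidHom.mk' (fun φ => evalPair A φ x) fun _ _ => evalPair_add_left A _ _ x) _ _

lemma map_evalPair {B : Type*} [CommRing B] [Algebra k B] (f : A →ₐ[k] B)
    (φ : A ⊗[k] Module.Dual k V) (x : A ⊗[k] V) :
    f (evalPair A φ x) =
      evalPair B (f.toLinearMap.rTensor _ φ) (f.toLinearMap.rTensor _ x) := by
  induction φ, x using tmul_induction₂ <;> simp_all [evalPair_add_left, evalPair_add_right]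

lemma pair_sum_left {W ι : Type*} [AddCommGroup W] [Module k W] (s : Finset ι)
    (p : ι → A ⊗[k] V) (q : A ⊗[k] W) : pair A (∑ i ∈ s, p i) q = ∑ i ∈ s, pair A (p i) q :=
  map_sum (AddMonoidHom.mk' (fun p => pair A p q) fun _ _ => pair_add_left A _ _ q) _ _

lemma pair_sum_right {W ι : Type*} [AddCommGroup W] [Module k W] (s : Finset ι)
    (p : A ⊗[k] V) (q : ι → A ⊗[k] W) : pair A p (∑ i ∈ s, q i) = ∑ i ∈ s, pair A p (q i) :=
  map_sum (AddMonoidHom.mk' (fun q => pair A p q) fun _ _ => pair_add_right A p _ _) _ _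

variable [FiniteDimensional k V]

/-- A fixed basis of a finite-dimensional vector space (the one used by Mathlib's
coevaluation). -/
noncomputable abbrev stdBasis (k V : Type*) [Field k] [AddCommGroup V] [Module k V] :=
  Module.Basis.ofVectorSpace k V

lemma sum_evalPair_smul_basis (x : A ⊗[k] V) :
    ∑ i, evalPair A (1 ⊗ₜ (stdBasis k V).coord i) x • ((1 : A) ⊗ₜ[k] stdBasis k V i) = x := by
  induction x using TensorProduct.induction_on with
  | zero => simp
  | add x y hx hy => simp only [evalPair_add_right, add_smul, Finset.sum_add_distrib, hx, hy]
  | tmul a v =>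
    simp only [evalPair_tmul, one_mul, TensorProduct.smul_tmul', smul_eq_mul, mul_one,
      TensorProduct.smul_tmul, ← TensorProduct.tmul_sum, Module.Basis.coord_apply,
      Module.Basis.sum_repr]

lemma sum_evalPair_smul_coord (φ : A ⊗[k] Module.Dual k V) :
    ∑ i, evalPair A φ (1 ⊗ₜ stdBasis k V i) • ((1 : A) ⊗ₜ[k] (stdBasis k V).coord i) = φ := by
  induction φ using TensorProduct.induction_on with
  | zero => simp
  | add x y hx hy => simp only [evalPair_add_left, add_smul, Finset.sum_add_distrib, hx, hy]
  | tmul a v =>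
    simp only [evalPair_tmul, mul_one, TensorProduct.smul_tmul', smul_eq_mul,
      TensorProduct.smul_tmul, ← TensorProduct.tmul_sum, Module.Basis.sum_dual_apply_smul_coord]

lemma evalPair_ext {φ ψ : A ⊗[k] Module.Dual k V}
    (h : ∀ v : V, evalPair A φ (1 ⊗ₜ v) = evalPair A ψ (1 ⊗ₜ v)) : φ = ψ := by
  rw [← sum_evalPair_smul_coord A φ, ← sum_evalPair_smul_coord A ψ]
  simp only [h]

/-- The transpose of an endomorphism of `A ⊗ V`, acting on `A ⊗ V*`. -/
noncomputable def transposeEnd (T : Module.End A (A ⊗[k] V)) :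
    Module.End A (A ⊗[k] Module.Dual k V) where
  toFun φ := ∑ i, evalPair A φ (T (1 ⊗ₜ stdBasis k V i)) • ((1 : A) ⊗ₜ[k] (stdBasis k V).coord i)
  map_add' φ ψ := by simp only [evalPair_add_left, add_smul, Finset.sum_add_distrib]
  map_smul' a φ := by simp only [evalPair_smul_left, mul_smul, Finset.smul_sum, RingHom.id_apply]

lemma evalPair_transposeEnd (T : Module.End A (A ⊗[k] V)) (φ : A ⊗[k] Module.Dual k V)
    (x : A ⊗[k] V) : evalPair A (transposeEnd A T φ) x = evalPair A φ (T x) := by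
  let L : A ⊗[k] V →ₗ[A] A :=
    { toFun := evalPair A φ
      map_add' := evalPair_add_right A φ
      map_smul' a x := evalPair_smul_right A a φ x }
  change _ = L (T x)
  conv_rhs => rw [← sum_evalPair_smul_basis A x]
  simp only [transposeEnd, LinearMap.coe_mk, AddHom.coe_mk, evalPair_sum_left,
    evalPair_smul_left, map_sum, map_smul, smul_eq_mul]
  exact Finset.sum_congr rfl fun i _ => mul_comm _ _

lemma transposeEnd_one : transposeEnd A (1 : Module.End A (A ⊗[k] V)) = 1 :=
  LinearMap.ext fun _ => evalPair_ext A fun _ => evalPair_transposeEnd A _ _ _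

lemma transposeEnd_mul (S T : Module.End A (A ⊗[k] V)) :
    transposeEnd A (S * T) = transposeEnd A T * transposeEnd A S :=
  LinearMap.ext fun _ => evalPair_ext A fun _ => by
    simp only [Module.End.mul_apply, evalPair_transposeEnd]

lemma rTensor_transposeEnd {B : Type*} [CommRing B] [Algebra k B] (f : A →ₐ[k] B)
    {S : Module.End A (A ⊗[k] V)} {T : Module.End B (B ⊗[k] V)}
    (h : ∀ x, f.toLinearMap.rTensor V (S x) = T (f.toLinearMap.rTensor V x))
    (φ : A ⊗[k] Module.Dual k V) :
    f.toLinearMap.rTensor _ (transposeEnd A S φ) =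
      transposeEnd B T (f.toLinearMap.rTensor _ φ) := by
  refine evalPair_ext B fun v => ?_
  have hv : (1 : B) ⊗ₜ[k] v = f.toLinearMap.rTensor V (1 ⊗ₜ v) := by simp
  rw [evalPair_transposeEnd, hv, ← h, ← map_evalPair, ← map_evalPair, evalPair_transposeEnd]

lemma contractLeft_pairEnd {S T : Module.End A (A ⊗[k] V)} (h : S * T = 1)
    (x : A ⊗[k] (Module.Dual k V ⊗[k] V)) :
    (contractLeft k V).baseChange A (pairEnd A (transposeEnd A S) T x) =
      (contractLeft k V).baseChange A x := by
  induction x using pair_induction (A := A) (V := Module.Dual k V) (W := V) with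
  | h0 => simp
  | hadd x y hx hy => simp only [map_add, hx, hy]
  | hp φ y =>
    rw [pairEnd_pair]
    apply (TensorProduct.AlgebraTensorModule.rid k A A).injective
    refine (evalPair_transposeEnd A S φ (T y)).trans ?_
    rw [← Module.End.mul_apply, h]
    rfl

lemma coevaluation_pairEnd {S T : Module.End A (A ⊗[k] V)} (h : S * T = 1) (x : A ⊗[k] k) :
    pairEnd A S (transposeEnd A T) ((coevaluation k V).baseChange A x) =
      (coevaluation k V).baseChange A x := by
  induction x using TensorProduct.induction_on with
  | zero => simp
  | add x y hx hy => simp only [map_add, hx, hy]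
  | tmul a c =>
    have hac : a ⊗ₜ[k] c = (c • a) • ((1 : A) ⊗ₜ[k] (1 : k)) := by
      rw [TensorProduct.smul_tmul', smul_eq_mul, mul_one, TensorProduct.smul_tmul, smul_eq_mul,
        mul_one]
    have hone : (coevaluation k V).baseChange A (1 ⊗ₜ 1) =
        ∑ i, pair A (1 ⊗ₜ stdBasis k V i) (1 ⊗ₜ (stdBasis k V).coord i) := by
      simp [coevaluation_apply_one, TensorProduct.tmul_sum]
    rw [hac, map_smul, map_smul, hone, map_sum]
    congr 1
    -- expand the transpose in the dual basis and move the coefficients to the other factor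
    have key (j) : ∑ i, pair A (S (1 ⊗ₜ stdBasis k V i))
        (evalPair A ((1 : A) ⊗ₜ[k] (stdBasis k V).coord i) (T (1 ⊗ₜ stdBasis k V j)) •
          ((1 : A) ⊗ₜ[k] (stdBasis k V).coord j)) =
        pair A (1 ⊗ₜ stdBasis k V j) (1 ⊗ₜ (stdBasis k V).coord j) := by
      simp only [pair_smul_right, ← pair_smul_left, ← map_smul]
      rw [← pair_sum_left, ← map_sum, sum_evalPair_smul_basis, ← Module.End.mul_apply, h]
      rfl
    simp only [pairEnd_pair, transposeEnd, LinearMap.coe_mk, AddHom.coe_mk, pair_sum_right]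
    rw [Finset.sum_comm]
    exact Finset.sum_congr rfl fun j _ => key j

end Contragredient

/-! ### Rigidity of the category of representations -/

namespace RepCat

variable {k : Type u} [Field k] {G : GroupFunctor k}

/-- The contragredient representation. -/
noncomputable def dual (X : RepCat G) : RepCat G where
  V := FGModuleCat.FGModuleCatDual k X.V
  ρ A :=
    { toFun g := transposeEnd (V := X.V) A (X.ρ A g⁻¹)
      map_one' := by
        rw [inv_one, map_one]
        exact transposeEnd_one (V := X.V) A
      map_mul' g h := by
        rw [mul_inv_rev, map_mul]
        exact transposeEnd_mul (V := X.V) A _ _ }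
  natural {A B} f g x :=
    rTensor_transposeEnd (V := X.V) (A : Type u) f.hom
      (fun y => (X.natural f g⁻¹ y).trans (by rw [map_inv])) x

/-- The evaluation `V* ⊗ V → k` of a representation. -/
noncomputable def dualEval (X : RepCat G) : tensor (dual X) X ⟶ triv G where
  hom := FGModuleCat.FGModuleCatEvaluation k X.V
  comm A g x := contractLeft_pairEnd (V := X.V) (A : Type u)
    (by rw [← map_mul, inv_mul_cancel, map_one]) x

/-- The coevaluation `k → V ⊗ V*` of a representation. -/
noncomputable def dualCoeval (X : RepCat G) : triv G ⟶ tensor X (dual X) where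
  hom := FGModuleCat.FGModuleCatCoevaluation k X.V
  comm A g x := (coevaluation_pairEnd (V := X.V) (A : Type u)
    (by rw [← map_mul, mul_inv_cancel, map_one]) x).symm

noncomputable instance (X : RepCat G) : HasRightDual X where
  rightDual := dual X
  exact :=
    letI : ExactPairing ((forget G).obj X) ((forget G).obj (dual X)) :=
      FGModuleCat.exactPairing k X.V
    ExactPairing.ofFaithful (forget G) (dualEval X) (dualCoeval X)
      (fgModuleCat_hom_ext rfl)
      (fgModuleCat_hom_ext rfl)

noncomputable instance : RightRigidCategory (RepCat G) where

noncomputable instance : RigidCategory (RepCat G) :=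
  BraidedCategory.rigidCategoryOfRightRigidCategory

/-! ### Representations as a neutral Tannakian category -/

lemma end_unit_bijective : Function.Bijective (fun c : k => c • 𝟙 (𝟙_ (RepCat G))) := by
  constructor
  · intro c d h
    have h1 := LinearMap.congr_fun (congrArg lin h) (1 : k)
    have h2 : c • (1 : k) = d • (1 : k) := h1
    simpa using h2
  · intro f
    let l : k →ₗ[k] k := lin f
    refine ⟨l 1, lin_ext ?_⟩
    change (l 1) • (LinearMap.id : k →ₗ[k] k) = l
    ext
    simp

/-- The neutral Tannakian category of finite-dimensional representations, with the forgetful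
functor as fibre functor. -/
noncomputable def tannakian (G : GroupFunctor k) : NeutralTannakianCategory k where
  C := RepCat G
  monoidalPreadditive := monoidalPreadditive_of_faithful (forget G)
  monoidalLinear :=
    have := monoidalPreadditive_of_faithful (forget G)
    .ofFaithful k (forget G)
  end_unit := end_unit_bijective
  fiber := forget G

/-- The identity, as an equivalence of the Tannakian category of representations with the
category of representations. -/
noncomputable def tannakianEquivalence (G : GroupFunctor k) :
    TannakianEquivalence (tannakian G) G where
  equiv := CategoryTheory.Equivalence.refl (C := RepCat G)
  braided := inferInstanceAs (𝟭 (RepCat G)).Braided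
  additive := inferInstanceAs (𝟭 (RepCat G)).Additive
  linear := inferInstanceAs ((𝟭 (RepCat G)).Linear k)
  fiberIso := Functor.leftUnitor (forget G)
  fiberIsoMonoidal := inferInstanceAs (NatTrans.IsMonoidal (Functor.leftUnitor (forget G)).hom)

end RepCat

end Bisemi

theorem proposition2p1 (k FR FL : Type u) [Field k] [NumberField k]
    [Field FR] [Algebra k FR] [FiniteDimensional k FR]
    [Field FL] [Algebra k FL] [FiniteDimensional k FL] (n : ℕ) :
    -- `GL_n(F_R × F_L)` is an affine bisemigroup scheme over `k`
    (Bisemi.GLn k FR FL n).IsAffine ∧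
    -- `V_R ⊗ V_L` is free of rank `n²` over `F_R ⊗ F_L`
    (letI := Bisemi.bisemispaceModule k FR FL n;
      Module.Free (FR ⊗[k] FL) (Bisemi.Bisemispace k FR FL n) ∧
      Module.finrank (FR ⊗[k] FL) (Bisemi.Bisemispace k FR FL n) = n ^ 2) ∧
    -- `GL_n(F_R × F_L)` acts on `V_R ⊗ V_L` right by left
    (∀ (A : CommAlgCat.{u} k) (a : Bisemi.lower n FR) (b : Bisemi.upper n FL)
      (v : Fin n → FR) (w : Fin n → FL),
      Bisemi.act k FR FL n A (Bisemi.point k FR FL n A a b) (1 ⊗ₜ[k] (v ⊗ₜ[k] w)) =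
        1 ⊗ₜ[k] (Matrix.vecMul v (a : GL (Fin n) FR).val ⊗ₜ[k]
          Matrix.mulVec (b : GL (Fin n) FL).val w)) ∧
    -- the action is linear over `F_R ⊗ F_L`
    (∀ (A : CommAlgCat.{u} k) (g : (Bisemi.GLn k FR FL n).total.obj A) (s : FR ⊗[k] FL)
      (x : A ⊗[k] Bisemi.Bisemispace k FR FL n),
      Bisemi.act k FR FL n A g ((Bisemi.scalar k FR FL n s).baseChange A x) =
        (Bisemi.scalar k FR FL n s).baseChange A (Bisemi.act k FR FL n A g x)) ∧
    -- `V_R ⊗ V_L` belongs to a neutral Tannakian category equivalent to the category of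
    -- finite-dimensional representations of `GL_n(F_R × F_L)`
    (∃ (T : Bisemi.NeutralTannakianCategory k)
      (E : Bisemi.TannakianEquivalence T (Bisemi.GLn k FR FL n).total) (X : T.C),
      Nonempty (E.equiv.functor.obj X ≅ Bisemi.Gn k FR FL n)) ∧
    -- likewise for the representations of any affine bisemigroup scheme
    (∀ H : Bisemi.BisemigroupFunctor k, H.IsAffine →
      ∃ T : Bisemi.NeutralTannakianCategory k,
        Nonempty (Bisemi.TannakianEquivalence T H.total)) :=

  ⟨⟨Bisemi.isAffine_lowerFunctor, Bisemi.isAffine_upperFunctor⟩,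
    Bisemi.free_bisemispace k FR FL n,
    Bisemi.act_point_one_tmul k FR FL n,
    Bisemi.act_scalar k FR FL n,
    ⟨Bisemi.RepCat.tannakian _, Bisemi.RepCat.tannakianEquivalence _, Bisemi.Gn k FR FL n,
      ⟨Iso.refl _⟩⟩,
    fun H _ => ⟨Bisemi.RepCat.tannakian H.total, ⟨Bisemi.RepCat.tannakianEquivalence H.total⟩⟩⟩
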